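/- Let $K$ be a number field of degree $d$ with ring of integers $\mathcal O$ and trace $\mathrm{Tr}=\mathrm{Tr}_{K/\mathbb Q}$, and let $\mathcal O^\vee=\{x\in K:\ \mathrm{Tr}(x\mathcal O)\subset\mathbb Z\}$. Fix a $\mathbb Z$-basis $(\omega_1,\dots,\omega_d)$ of $\mathcal O$ and a norm on $\mathbb R^d$; for $x=\sum_j x_j\omega_j\in K$ $(x_j\in\mathbb Q)$ let $\|x\|$ be the norm of $(x_1,\dots,x_d)$. Write $\mathrm e(z)=e^{2\pi i z}$. Let $(q,\mathcal D)$ be a number system with the finiteness property: $q\in\mathcal O$ has all its conjugates of modulus $>1$, $\mathcal D\subset\mathcal O$ is a set of representatives of $\mathcal O/(q)$ containing $0$, and every $n\in\mathcal O$ has a finite expansion $n=\sum_{j\ge 0} n_jq^j$ with $n_j\in\mathcal D$. Let $Q=|N_{K/\mathbb Q}(q)|$ and $\mathcal N_\kappa=\{\sum_{0\le j<\kappa}b_jq^j:\ b_j\in\mathcal D\}$, which is a set of representatives of $\mathcal O/(q^\kappa)$. For $n=\sum_j n_jq^j$ put $r_{\nu,\infty}(n)=\sum_{j\ge 0}n_{\nu+j}q^j$.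 A number $\eta_2\in(0,1]$ is called a carry constant of $(q,\mathcal D)$ if there is a constant $C_0$ such that for all integers $0\le\rho\le\nu\le\mu$, $$\#\{m\in\mathcal N_\mu:\ \exists n\in\mathcal N_{\nu-\rho},\ r_{\nu,\infty}(m+n)\ne r_{\nu,\infty}(m)\}\le C_0\,Q^{\mu-\eta_2\rho}.$$ For $f:\mathcal O\to\mathbb C$ let $f_\kappa$ be the function that is periodic modulo $q^\kappa$ and equal to $f$ on $\mathcal N_\kappa$. We say that $f$ has the Carry property with exponent $\eta_1>0$ and constant $C_1$ if for all $\kappa,\lambda,\rho\in\mathbb N$ with $\rho\le\lambda$, the number of $v\in\mathcal N_\lambda$ such that $$f(u_1+u_2+vq^\kappa)\overline{f(u_1+vq^\kappa)}\ne f_{\kappa+\rho}(u_1+u_2+vq^\kappa)\overline{f_{\kappa+\rho}(u_1+vq^\kappa)}$$ for some $u_1,u_2\in\mathcal N_\kappa$ is at most $C_1Q^{\lambda-\eta_1\rho}$. We say that $f$ has the Fourier property with a non-decreasing function $\gamma:\mathbb N\to[0,\infty)$, a number $c>0$ and constant $C_2$ if $\big|\sum_{v\in\mathcal N_\lambda}f(vq^\kappa)\,\mathrm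 e(\mathrm{Tr}(tv))\big|\le C_2Q^{\lambda-\gamma(\lambda)}$ for all $\lambda,\kappa\in\mathbb N$ with $\kappa\le c\lambda$ and all $t\in K$. Then $(q,\mathcal D)$ has a carry constant. Moreover, for every carry constant $\eta_2$ and all $C_1,C_2$ there is a constant $C$, depending only on $K$, $(\omega_j)$, the norm, $(q,\mathcal D)$, $\eta_2$, $C_1$ and $C_2$, such that the following holds. Let $f:\mathcal O\to\mathbb C$ satisfy $|f(n)|=1$ for all $n$, and have the Carry property with $\eta_1$, $C_1$ and the Fourier property with $\gamma$, $c$, $C_2$. Let $\mu_0<\mu_1<\mu<\mu_2$ be natural numbers, $\sigma=\mu_2-\mu_0$, and for $n\in\mathcal O$ and $x\in K$ put $$g(n)=f_{\mu_2}(q^{\mu_0}n)\overline{f_{\mu_1}(q^{\mu_0}n)},\qquad \hat g(x)=\frac1{Q^\sigma}\sum_{u\in\mathcal N_\sigma}g(u)\,\mathrm e\Big(\mathrm{Tr}\Big(\frac{-ux}{q^\sigma}\Big)\Big).$$ Then for all $t\in K$ and all $\lambda\in\mathbb N$ with $c^{-1}\mu_0\le\lambda\le\sigma$, there are only finitely many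 $h\in\mathcal O^\vee$ with $\|h/q^{\sigma-\lambda}\|\le 1$, and $$\sum_{\substack{h\in\mathcal O^\vee\\ \|h/q^{\sigma-\lambda}\|\le 1}}|\hat g(h+t)|^2\le C\,Q^{2(\mu_1-\mu_0)}\Big(Q^{-\eta''\gamma(\lambda)}+Q^{-\eta_1(\sigma-\lambda)}\Big),\qquad \eta''=\frac{2\eta_1\eta_2}{(2+\eta_1)(1+\eta_2)}.$$ -/

import Mathlib

open scoped NumberField

noncomputable section

namespace DigitalFourier

open scoped Classical

variable {K : Type*} [Field K] [NumberField K]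

/-- `(q, D)` is a number system with the finiteness property: all conjugates of `q` have modulus
greater than `1`, `D` is a set of representatives of `𝓞 K / (q)` containing `0`, and every
`n : 𝓞 K` has a finite base-`q` expansion with digits in `D`. -/
structure IsFNS (q : 𝓞 K) (D : Finset (𝓞 K)) : Prop where
  one_lt_conj : ∀ φ : K →+* ℂ, 1 < ‖φ (q : K)‖
  zero_mem : (0 : 𝓞 K) ∈ D
  representatives : ∀ n : 𝓞 K, ∃! b : 𝓞 K, b ∈ D ∧ q ∣ n - b
  finiteness : ∀ n : 𝓞 K, ∃ (r : ℕ) (b : ℕ → 𝓞 K),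
    (∀ j, b j ∈ D) ∧ n = ∑ j ∈ Finset.range r, b j * q ^ j

/-- `Q = N(q)`, the absolute value of the norm of `q`. -/
def absNorm (q : 𝓞 K) : ℝ := ((Algebra.norm ℤ q).natAbs : ℝ)

/-- `𝒩_κ`, the set of the integers `∑_{0 ≤ j < κ} b_j q ^ j` with digits `b_j ∈ D`. -/
def digitSet (q : 𝓞 K) (D : Finset (𝓞 K)) (κ : ℕ) : Finset (𝓞 K) :=
  (Fintype.piFinset fun _ : Fin κ => D).image fun b => ∑ j : Fin κ, b j * q ^ (j : ℕ)

/-- `r_{0,κ}(n)`, the integer formed with the digits of `n` of index less than `κ`. It is the only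
element of `𝒩_κ` congruent to `n` modulo `q ^ κ`. -/
def lowDigits (q : 𝓞 K) (D : Finset (𝓞 K)) (κ : ℕ) (n : 𝓞 K) : 𝓞 K :=
  Classical.epsilon fun m => m ∈ digitSet q D κ ∧ q ^ κ ∣ n - m

/-- `r_{κ,∞}(n)`, the integer formed with the digits of `n` of index at least `κ`, shifted down:
the `k` with `n = r_{0,κ}(n) + q ^ κ * k`. -/
def highDigits (q : 𝓞 K) (D : Finset (𝓞 K)) (κ : ℕ) (n : 𝓞 K) : 𝓞 K :=
  Classical.epsilon fun k => n = lowDigits q D κ n + q ^ κ * k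

/-- `f_κ`, the function that is periodic modulo `q ^ κ` and coincides with `f` on `𝒩_κ`. -/
def truncate (q : 𝓞 K) (D : Finset (𝓞 K)) (f : 𝓞 K → ℂ) (κ : ℕ) (n : 𝓞 K) : ℂ :=
  f (lowDigits q D κ n)

/-- `e(Tr x) = exp(2 π i Tr x)`. -/
def traceChar (x : K) : ℂ :=
  Complex.exp (2 * (Real.pi : ℂ) * Complex.I * ((Algebra.trace ℚ K x : ℚ) : ℂ))

/-- The Carry property with exponent `η₁` and implied constant `C₁`. -/
def CarryProperty (q : 𝓞 K) (D : Finset (𝓞 K)) (f : 𝓞 K → ℂ) (η₁ C₁ : ℝ) : Prop :=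
  0 < η₁ ∧ ∀ κ l ρ : ℕ, ρ ≤ l →
    (((digitSet q D l).filter fun v => ∃ u₁ ∈ digitSet q D κ, ∃ u₂ ∈ digitSet q D κ,
        f (u₁ + u₂ + v * q ^ κ) * star (f (u₁ + v * q ^ κ)) ≠
          truncate q D f (κ + ρ) (u₁ + u₂ + v * q ^ κ) *
            star (truncate q D f (κ + ρ) (u₁ + v * q ^ κ))).card : ℝ)
      ≤ C₁ * absNorm q ^ ((l : ℝ) - η₁ * (ρ : ℝ))

/-- The Fourier property with rate `γ`, range `c` and implied constant `C₂`. -/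
def FourierProperty (q : 𝓞 K) (D : Finset (𝓞 K)) (f : 𝓞 K → ℂ) (γ : ℕ → ℝ) (c C₂ : ℝ) : Prop :=
  Monotone γ ∧ (∀ l, 0 ≤ γ l) ∧ 0 < c ∧
    ∀ (l κ : ℕ) (t : K), (κ : ℝ) ≤ c * (l : ℝ) →
      ‖∑ v ∈ digitSet q D l, f (v * q ^ κ) * traceChar (t * (v : K))‖
        ≤ C₂ * absNorm q ^ ((l : ℝ) - γ l)

/-- `η₂` is a carry constant of `(q, D)`: adding an element of `𝒩_{ν-ρ}` to `m ∈ 𝒩_μ` changes the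
digits of index at least `ν` for at most `O(Q ^ (μ - η₂ ρ))` values of `m`. -/
def IsCarryConstant (q : 𝓞 K) (D : Finset (𝓞 K)) (η₂ : ℝ) : Prop :=
  0 < η₂ ∧ η₂ ≤ 1 ∧ ∃ C : ℝ, ∀ ρ ν μ : ℕ, ρ ≤ ν → ν ≤ μ →
    (((digitSet q D μ).filter fun m => ∃ n ∈ digitSet q D (ν - ρ),
        highDigits q D ν (m + n) ≠ highDigits q D ν m).card : ℝ)
      ≤ C * absNorm q ^ ((μ : ℝ) - η₂ * (ρ : ℝ))

/-- The function `g(n) = f_{μ₂}(q ^ μ₀ n) * conj (f_{μ₁}(q ^ μ₀ n))`. -/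
def middleFunction (q : 𝓞 K) (D : Finset (𝓞 K)) (f : 𝓞 K → ℂ) (μ₀ μ₁ μ₂ : ℕ) (n : 𝓞 K) : ℂ :=
  truncate q D f μ₂ (q ^ μ₀ * n) * star (truncate q D f μ₁ (q ^ μ₀ * n))

/-- The discrete Fourier transform `ĝ(x) = Q ^ (-σ) ∑_u g(u) e(Tr(-u x / q ^ σ))` for `x : K`, where
`u` runs over the representatives `𝒩_σ` of `𝓞 K / (q ^ σ)`. -/
def discreteFourier (q : 𝓞 K) (D : Finset (𝓞 K)) (σ : ℕ) (g : 𝓞 K → ℂ) (x : K) : ℂ :=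
  (1 / (absNorm q : ℂ) ^ σ) *
    ∑ u ∈ digitSet q D σ, g u * traceChar (-((u : K) * x) / (q : K) ^ σ)

/-- `ι⁻¹(x)`, the coordinates of `x : K` in a `ℤ`-basis `ω` of `𝓞 K`. -/
def coords {ι : Type*} (ω : Module.Basis ι ℤ (𝓞 K)) (x : K) : ι → ℝ :=
  fun i => (((ω.localizationLocalization ℚ (nonZeroDivisors ℤ) K).repr x i : ℚ) : ℝ)

/-- The set of the `h` in the trace dual of `𝓞 K` with `‖h / q ^ k‖ ≤ 1`, where `‖x‖` is the norm
`nrm` of the coordinates of `x` in the basis `ω`. -/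
def frequencySet {ι : Type*} (ω : Module.Basis ι ℤ (𝓞 K)) (nrm : Seminorm ℝ (ι → ℝ))
    (q : 𝓞 K) (k : ℕ) : Set K :=
  {h : K | h ∈ Submodule.traceDual ℤ ℚ (1 : Submodule (𝓞 K) K) ∧
    nrm (coords ω (h / (q : K) ^ k)) ≤ 1}

end DigitalFourier

end

noncomputable section

namespace DigitalFourier

open scoped Classical

variable {K : Type*} [Field K] [NumberField K]

set_option linter.unusedSectionVars false

/-! ### Digit expansions as representatives modulo powers of `q`. -/

section Digits

variable {q : 𝓞 K} {D : Finset (𝓞 K)}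

/-! Carry constant. Since `q` is expanding at every embedding, the carries produced by adding two
digit strings of equal length lie in a fixed finite set `E`. By finiteness of expansions every `c ∈
E` fits into `r` digits, so a block of `r` zeros absorbs it. A carry thus survives a block of `r`
digits for at most `Q ^ r - 1` of the `Q ^ r` blocks, which gives geometric decay.

Main estimate. Write `l = λ` and `k = σ - l`. For `n ∈ 𝒩_σ` the factor `f_{μ₂}(q ^ μ₀ n)` is just
`f(q ^ μ₀ n)`. The other factor is periodic modulo `q ^ (μ₁ - μ₀)`: expanding it in `Q ^ (μ₁ - μ₀)`
characters and using Cauchy-Schwarz costs `Q ^ (2(μ₁ - μ₀))`, so it suffices to treat `F(n) = f(q ^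
μ₀ n)`, uniformly in the twist (`sum_sq_norm_mul_periodic_le`).

The frequencies `h / q ^ σ` have conjugates of size `O(|φ(q)| ^ (-l))`, so their characters are
nearly 1 on `𝒩_M` with `M = l - ρ₂`. Multiplying the exponential sum by the sum of the character
over `𝒩_M` therefore loses nothing, and a shift of variable turns the product into the transform of
the block sums `∑_s F(n + s)`; pairs `(n, s)` with a carry beyond `l` digits are rare by the carry
constant. Distinct `h` rarely give the same character modulo `q ^ σ`, so Bessel's inequality bounds
the sum over `h` by the mean square of the block sums (`sum_sq_norm_frequencies_le`).

Write `n = a + q ^ l v`. For most `v` the Carry property lets `v` be replaced by its first `ρ₁`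
digits, at the price of a unimodular factor independent of `s`. Parseval modulo `q ^ (l + ρ₁)` then
bounds the mean square by the largest Fourier coefficient of `F` there, which the Fourier property
controls (`sum_sq_norm_noCarry_block_le`).

The normalized total is `O(Q ^ (-η₁ρ₁) + Q ^ (-η₂ρ₂) + Q ^ (ρ₁ + ρ₂ - 2γ(l)))`, and
`exists_block_lengths` chooses `ρ₁` and `ρ₂`. -/

theorem mem_digitSet {κ : ℕ} {n : 𝓞 K} :
    n ∈ digitSet q D κ ↔
      ∃ b : Fin κ → 𝓞 K, (∀ j, b j ∈ D) ∧ ∑ j : Fin κ, b j * q ^ (j : ℕ) = n := by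
  simp [digitSet, Fintype.mem_piFinset]

theorem mem_digitSet_add {κ l : ℕ} {n : 𝓞 K} :
    n ∈ digitSet q D (κ + l) ↔
      ∃ a ∈ digitSet q D κ, ∃ b ∈ digitSet q D l, a + q ^ κ * b = n := by
  constructor
  · intro h
    obtain ⟨b, hb, rfl⟩ := mem_digitSet.1 h
    refine ⟨_, mem_digitSet.2 ⟨fun j => b (Fin.castAdd l j), fun j => hb _, rfl⟩, _,
      mem_digitSet.2 ⟨fun j => b (Fin.natAdd κ j), fun j => hb _, rfl⟩, ?_⟩
    rw [Fin.sum_univ_add, Finset.mul_sum]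
    congr 1
    refine Finset.sum_congr rfl fun j _ => ?_
    simp only [Fin.val_natAdd, pow_add]
    ring
  · rintro ⟨a, ha, b, hb, rfl⟩
    obtain ⟨x, hx, rfl⟩ := mem_digitSet.1 ha
    obtain ⟨y, hy, rfl⟩ := mem_digitSet.1 hb
    refine mem_digitSet.2 ⟨Fin.append x y, fun j => ?_, ?_⟩
    · refine Fin.addCases (fun i => ?_) (fun i => ?_) j
      · simpa using hx i
      · simpa using hy i
    · rw [Fin.sum_univ_add, Finset.mul_sum]
      congr 1
      · simp
      · refine Finset.sum_congr rfl fun j _ => ?_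
        simp only [Fin.append_right, Fin.val_natAdd, pow_add]
        ring

theorem digitSet_zero : digitSet q D 0 = {0} := by
  ext n
  simp [mem_digitSet, eq_comm]

theorem mem_digitSet_one {n : 𝓞 K} : n ∈ digitSet q D 1 ↔ n ∈ D := by
  rw [mem_digitSet]
  constructor
  · rintro ⟨b, hb, rfl⟩
    simpa using hb 0
  · intro h
    exact ⟨fun _ => n, fun _ => h, by simp⟩

theorem natCard_quotient (κ : ℕ) :
    (Nat.card (𝓞 K ⧸ Ideal.span {q ^ κ}) : ℝ) = absNorm q ^ κ := by
  have h := Ideal.absNorm_span_singleton (q ^ κ)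
  rw [Ideal.absNorm_apply, Submodule.cardQuot_apply] at h
  rw [h, map_pow, Int.natAbs_pow, absNorm]
  push_cast
  rfl

namespace IsFNS


theorem ne_zero (hqD : IsFNS q D) : q ≠ 0 := by
  rintro rfl
  obtain ⟨φ⟩ : Nonempty (K →+* ℂ) := inferInstance
  have := hqD.one_lt_conj φ
  simp at this
  linarith

theorem coe_ne_zero (hqD : IsFNS q D) : (q : K) ≠ 0 := by
  simpa using hqD.ne_zero

theorem one_lt_absNorm (hqD : IsFNS q D) : 1 < absNorm q := by
  have h1 : (Algebra.norm ℚ (q : K) : ℚ) = ((Algebra.norm ℤ q : ℤ) : ℚ) :=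
    (Algebra.coe_norm_int q).symm
  have h2 := Algebra.norm_eq_prod_embeddings ℚ ℂ (q : K)
  rw [h1] at h2
  have h3 : absNorm q = ∏ φ : K →ₐ[ℚ] ℂ, ‖φ (q : K)‖ := by
    rw [← norm_prod, ← h2, absNorm, Nat.cast_natAbs]
    simp
  rw [h3]
  obtain ⟨φ₀⟩ : Nonempty (K →+* ℂ) := inferInstance
  have hpos := fun φ : K →ₐ[ℚ] ℂ => hqD.one_lt_conj φ.toRingHom
  rw [← Finset.mul_prod_erase _ _ (Finset.mem_univ φ₀.toRatAlgHom)]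
  refine one_lt_mul_of_lt_of_le (hpos _) (Finset.one_le_prod fun φ _ => (hpos φ).le)

theorem two_le_absNorm (hqD : IsFNS q D) : 2 ≤ absNorm q := by
  have h := hqD.one_lt_absNorm
  unfold absNorm at *
  exact_mod_cast h

theorem absNorm_pos (hqD : IsFNS q D) : 0 < absNorm q := zero_lt_one.trans hqD.one_lt_absNorm

theorem zero_mem_digitSet (hqD : IsFNS q D) (κ : ℕ) : (0 : 𝓞 K) ∈ digitSet q D κ :=
  mem_digitSet.2 ⟨fun _ => 0, fun _ => hqD.zero_mem, by simp⟩

theorem mem_digitSet_of_le (hqD : IsFNS q D) {κ l : ℕ} (h : κ ≤ l) {n : 𝓞 K} (hn : n ∈ digitSet q D κ) :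
    n ∈ digitSet q D l := by
  obtain ⟨k, rfl⟩ := Nat.exists_eq_add_of_le h
  exact mem_digitSet_add.2 ⟨n, hn, 0, hqD.zero_mem_digitSet k, by simp⟩

theorem pow_mul_mem (hqD : IsFNS q D) {κ l : ℕ} {n : 𝓞 K} (hn : n ∈ digitSet q D l) :
    q ^ κ * n ∈ digitSet q D (κ + l) :=
  mem_digitSet_add.2 ⟨0, hqD.zero_mem_digitSet κ, n, hn, by simp⟩

theorem exists_mem_digitSet (hqD : IsFNS q D) (n : 𝓞 K) : ∃ r, n ∈ digitSet q D r := by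
  obtain ⟨r, b, hb, rfl⟩ := hqD.finiteness n
  exact ⟨r, mem_digitSet.2 ⟨fun j => b j, fun j => hb j,
    Fin.sum_univ_eq_sum_range (fun j => b j * q ^ j) r⟩⟩

theorem exists_dvd_sub (hqD : IsFNS q D) (κ : ℕ) (n : 𝓞 K) : ∃ m ∈ digitSet q D κ, q ^ κ ∣ n - m := by
  induction κ with
  | zero => exact ⟨0, hqD.zero_mem_digitSet 0, by simp⟩
  | succ κ ih =>
    obtain ⟨m, hm, k, hk⟩ := ih
    obtain ⟨b, ⟨hb, j, hj⟩, -⟩ := hqD.representatives k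
    refine ⟨m + q ^ κ * b, mem_digitSet_add.2 ⟨m, hm, b, mem_digitSet_one.2 hb, rfl⟩, j, ?_⟩
    have : n - (m + q ^ κ * b) = (n - m) - q ^ κ * b := by ring
    rw [this, hk, ← mul_sub, hj]
    ring

/-- The lower digits agree by induction modulo `q ^ κ`; cancelling `q ^ κ` leaves two top digits
congruent modulo `q`. -/
theorem eq_of_dvd_sub (hqD : IsFNS q D) {κ : ℕ} {m m' : 𝓞 K} (hm : m ∈ digitSet q D κ)
    (hm' : m' ∈ digitSet q D κ) (h : q ^ κ ∣ m - m') : m = m' := by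
  induction κ generalizing m m' with
  | zero =>
    rw [digitSet_zero, Finset.mem_singleton] at hm hm'
    rw [hm, hm']
  | succ κ ih =>
    obtain ⟨a, ha, b, hb, rfl⟩ := mem_digitSet_add.1 hm
    obtain ⟨a', ha', b', hb', rfl⟩ := mem_digitSet_add.1 hm'
    rw [mem_digitSet_one] at hb hb'
    obtain ⟨k, hk⟩ := h
    have haa : a = a' := by
      refine ih ha ha' ⟨q * k - (b - b'), ?_⟩
      rw [pow_succ] at hk
      linear_combination hk
    subst haa
    have hbb : b - b' = q * k := by
      refine mul_left_cancel₀ (pow_ne_zero κ hqD.ne_zero) ?_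
      rw [pow_succ] at hk
      linear_combination hk
    have := (hqD.representatives b).unique ⟨hb, by simp⟩ ⟨hb', k, hbb⟩
    rw [this]

theorem lowDigits_spec (hqD : IsFNS q D) (κ : ℕ) (n : 𝓞 K) :
    lowDigits q D κ n ∈ digitSet q D κ ∧ q ^ κ ∣ n - lowDigits q D κ n := by
  obtain ⟨m, hm⟩ := hqD.exists_dvd_sub κ n
  exact Classical.epsilon_spec (p := fun m => m ∈ digitSet q D κ ∧ q ^ κ ∣ n - m) ⟨m, hm⟩

theorem lowDigits_mem (hqD : IsFNS q D) (κ : ℕ) (n : 𝓞 K) : lowDigits q D κ n ∈ digitSet q D κ :=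
  (hqD.lowDigits_spec κ n).1

theorem lowDigits_eq (hqD : IsFNS q D) {κ : ℕ} {n m : 𝓞 K} (hm : m ∈ digitSet q D κ) (h : q ^ κ ∣ n - m) :
    lowDigits q D κ n = m := by
  refine hqD.eq_of_dvd_sub (hqD.lowDigits_mem κ n) hm ?_
  have := dvd_sub h (hqD.lowDigits_spec κ n).2
  rwa [sub_sub_sub_cancel_left] at this

theorem lowDigits_of_mem (hqD : IsFNS q D) {κ : ℕ} {n : 𝓞 K} (hn : n ∈ digitSet q D κ) :
    lowDigits q D κ n = n :=
  hqD.lowDigits_eq hn (by simp)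

theorem lowDigits_congr (hqD : IsFNS q D) {κ : ℕ} {n m : 𝓞 K} (h : q ^ κ ∣ n - m) :
    lowDigits q D κ n = lowDigits q D κ m := by
  refine hqD.lowDigits_eq (hqD.lowDigits_mem κ m) ?_
  have := dvd_add h (hqD.lowDigits_spec κ m).2
  rwa [sub_add_sub_cancel] at this

theorem lowDigits_add_lowDigits (hqD : IsFNS q D) (κ : ℕ) (n m : 𝓞 K) :
    lowDigits q D κ (lowDigits q D κ n + m) = lowDigits q D κ (n + m) := by
  refine hqD.lowDigits_congr ?_
  have := (hqD.lowDigits_spec κ n).2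
  rw [← dvd_neg] at this
  convert this using 1
  ring

theorem lowDigits_add_highDigits (hqD : IsFNS q D) (κ : ℕ) (n : 𝓞 K) :
    n = lowDigits q D κ n + q ^ κ * highDigits q D κ n := by
  obtain ⟨k, hk⟩ := (hqD.lowDigits_spec κ n).2
  exact Classical.epsilon_spec (p := fun k => n = lowDigits q D κ n + q ^ κ * k)
    ⟨k, by rw [← hk]; ring⟩

theorem highDigits_eq (hqD : IsFNS q D) {κ : ℕ} {n m k : 𝓞 K} (hm : m ∈ digitSet q D κ) (h : n = m + q ^ κ * k) :
    highDigits q D κ n = k := by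
  have h1 := hqD.lowDigits_add_highDigits κ n
  rw [hqD.lowDigits_eq hm ⟨k, by rw [h]; ring⟩] at h1
  exact (mul_left_cancel₀ (pow_ne_zero κ hqD.ne_zero) (add_left_cancel (h.symm.trans h1))).symm

theorem highDigits_of_mem (hqD : IsFNS q D) {κ : ℕ} {n : 𝓞 K} (hn : n ∈ digitSet q D κ) :
    highDigits q D κ n = 0 :=
  hqD.highDigits_eq hn (by simp)

theorem highDigits_eq_zero_iff (hqD : IsFNS q D) {κ : ℕ} {n : 𝓞 K} :
    highDigits q D κ n = 0 ↔ n ∈ digitSet q D κ := by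
  refine ⟨fun h => ?_, hqD.highDigits_of_mem⟩
  have h1 := hqD.lowDigits_add_highDigits κ n
  rw [h, mul_zero, add_zero] at h1
  rw [h1]
  exact hqD.lowDigits_mem κ n

theorem highDigits_add_mul (hqD : IsFNS q D) (κ : ℕ) (n k : 𝓞 K) :
    highDigits q D κ (n + q ^ κ * k) = highDigits q D κ n + k := by
  refine hqD.highDigits_eq (hqD.lowDigits_mem κ n) ?_
  conv_lhs => rw [hqD.lowDigits_add_highDigits κ n]
  ring

theorem highDigits_add (hqD : IsFNS q D) (κ l : ℕ) (n : 𝓞 K) :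
    highDigits q D (κ + l) n = highDigits q D l (highDigits q D κ n) := by
  refine hqD.highDigits_eq (mem_digitSet_add.2 ⟨_, hqD.lowDigits_mem κ n, _,
    hqD.lowDigits_mem l (highDigits q D κ n), rfl⟩) ?_
  conv_lhs => rw [hqD.lowDigits_add_highDigits κ n,
    hqD.lowDigits_add_highDigits l (highDigits q D κ n)]
  rw [pow_add]
  ring

theorem add_mul_injOn (hqD : IsFNS q D) {κ : ℕ} {a a' b b' : 𝓞 K} (ha : a ∈ digitSet q D κ)
    (ha' : a' ∈ digitSet q D κ) (h : a + q ^ κ * b = a' + q ^ κ * b') : a = a' ∧ b = b' := by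
  have h1 := hqD.lowDigits_eq (n := a + q ^ κ * b) ha ⟨b, by ring⟩
  have h2 := hqD.lowDigits_eq (n := a + q ^ κ * b) ha' ⟨b', by rw [h]; ring⟩
  have h3 := hqD.highDigits_eq (n := a + q ^ κ * b) ha rfl
  have h4 := hqD.highDigits_eq (n := a + q ^ κ * b) ha' h
  exact ⟨h1.symm.trans h2, h3.symm.trans h4⟩

theorem sum_digitSet_add (hqD : IsFNS q D) {M : Type*} [AddCommMonoid M] (κ l : ℕ) (F : 𝓞 K → M) :
    ∑ n ∈ digitSet q D (κ + l), F n =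
      ∑ a ∈ digitSet q D κ, ∑ b ∈ digitSet q D l, F (a + q ^ κ * b) := by
  rw [← Finset.sum_product']
  symm
  refine Finset.sum_bij (fun p _ => p.1 + q ^ κ * p.2) ?_ ?_ ?_ ?_
  · rintro ⟨a, b⟩ h
    rw [Finset.mem_product] at h
    exact mem_digitSet_add.2 ⟨a, h.1, b, h.2, rfl⟩
  · rintro ⟨a, b⟩ h ⟨a', b'⟩ h' e
    rw [Finset.mem_product] at h h'
    obtain ⟨h1, h2⟩ := hqD.add_mul_injOn h.1 h'.1 e
    exact Prod.ext h1 h2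
  · intro n hn
    obtain ⟨a, ha, b, hb, h⟩ := mem_digitSet_add.1 hn
    exact ⟨(a, b), Finset.mem_product.2 ⟨ha, hb⟩, h⟩
  · intros; rfl

/-- Translation by `s` permutes the residues modulo `q ^ κ`. -/
theorem sum_lowDigits_add (hqD : IsFNS q D) {M : Type*} [AddCommMonoid M] (κ : ℕ) (s : 𝓞 K) (F : 𝓞 K → M) :
    ∑ n ∈ digitSet q D κ, F (lowDigits q D κ (n + s)) = ∑ n ∈ digitSet q D κ, F n := by
  refine Finset.sum_bij (fun n _ => lowDigits q D κ (n + s)) (fun n _ => hqD.lowDigits_mem _ _)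
    ?_ ?_ (fun _ _ => rfl)
  · intro a ha b hb h
    refine hqD.eq_of_dvd_sub ha hb ?_
    have h1 := (hqD.lowDigits_spec κ (a + s)).2
    have h2 := (hqD.lowDigits_spec κ (b + s)).2
    change lowDigits q D κ (a + s) = lowDigits q D κ (b + s) at h
    rw [h] at h1
    have := dvd_sub h1 h2
    convert this using 1
    ring
  · intro b hb
    refine ⟨lowDigits q D κ (b - s), hqD.lowDigits_mem _ _, ?_⟩
    rw [hqD.lowDigits_add_lowDigits, sub_add_cancel, hqD.lowDigits_of_mem hb]

theorem bijective_mk_digitSet (hqD : IsFNS q D) (κ : ℕ) :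
    Function.Bijective (fun n : digitSet q D κ =>
      (Ideal.Quotient.mk (Ideal.span {q ^ κ}) (n : 𝓞 K))) := by
  constructor
  · rintro ⟨a, ha⟩ ⟨b, hb⟩ h
    rw [Ideal.Quotient.mk_eq_mk_iff_sub_mem, Ideal.mem_span_singleton] at h
    exact Subtype.ext (hqD.eq_of_dvd_sub ha hb h)
  · intro x
    obtain ⟨n, rfl⟩ := Ideal.Quotient.mk_surjective x
    refine ⟨⟨_, hqD.lowDigits_mem κ n⟩, ?_⟩
    simp only
    rw [eq_comm, Ideal.Quotient.mk_eq_mk_iff_sub_mem, Ideal.mem_span_singleton]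
    exact (hqD.lowDigits_spec κ n).2

theorem card_digitSet (hqD : IsFNS q D) (κ : ℕ) : ((digitSet q D κ).card : ℝ) = absNorm q ^ κ := by
  rw [← natCard_quotient κ,
    ← Nat.card_congr (Equiv.ofBijective _ (hqD.bijective_mk_digitSet κ))]
  simp

end IsFNS

end Digits

/-! ### Propagation of carries and existence of a carry constant. -/

section Carry

variable {q : 𝓞 K} {D : Finset (𝓞 K)}

/-- The elements of `𝒩_κ` have conjugates of size `O(|φ(q)| ^ κ)`. -/
theorem IsFNS.exists_conj_bound (hqD : IsFNS q D) :
    ∃ θ B : ℝ, 1 < θ ∧ 0 < B ∧ (∀ φ : K →+* ℂ, θ ≤ ‖φ (q : K)‖) ∧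
      ∀ (κ : ℕ), ∀ m ∈ digitSet q D κ, ∀ φ : K →+* ℂ,
        ‖φ (m : K)‖ ≤ B * ‖φ (q : K)‖ ^ κ := by
  obtain ⟨φ₀, h₀⟩ := Finite.exists_min (fun φ : K →+* ℂ => ‖φ (q : K)‖)
  set θ := ‖φ₀ (q : K)‖ with hθ
  have hθ1 : 1 < θ := hqD.one_lt_conj φ₀
  set A : ℝ := 1 + ∑ d ∈ D, ∑ φ : K →+* ℂ, ‖φ (d : K)‖ with hA
  have hA0 : 0 < A := by positivity
  have hdA : ∀ d ∈ D, ∀ φ : K →+* ℂ, ‖φ (d : K)‖ ≤ A := by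
    intro d hd φ
    have h1 : ‖φ (d : K)‖ ≤ ∑ φ : K →+* ℂ, ‖φ (d : K)‖ :=
      Finset.single_le_sum (f := fun φ : K →+* ℂ => ‖φ (d : K)‖)
        (fun _ _ => norm_nonneg _) (Finset.mem_univ φ)
    have h2 : ∑ φ : K →+* ℂ, ‖φ (d : K)‖ ≤ ∑ d ∈ D, ∑ φ : K →+* ℂ, ‖φ (d : K)‖ :=
      Finset.single_le_sum (f := fun d : 𝓞 K => ∑ φ : K →+* ℂ, ‖φ (d : K)‖)
        (fun _ _ => by positivity) hd
    linarith
  -- Geometric series: `B = A / (θ - 1)` satisfies `A ≤ B (x - 1)` for `x ≥ θ`, which is what the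
  -- induction needs to add one digit.
  refine ⟨θ, A / (θ - 1), hθ1, div_pos hA0 (by linarith), h₀, ?_⟩
  intro κ
  induction κ with
  | zero =>
    intro m hm φ
    rw [digitSet_zero, Finset.mem_singleton] at hm
    subst hm
    simp only [map_zero, norm_zero, pow_zero, mul_one]
    exact (div_pos hA0 (by linarith)).le
  | succ κ ih =>
    intro m hm φ
    obtain ⟨a, ha, b, hb, rfl⟩ := mem_digitSet_add.1 hm
    rw [mem_digitSet_one] at hb
    set x := ‖φ (q : K)‖ with hx
    have hθx : θ ≤ x := h₀ φ
    have h1 : ‖φ ((a + q ^ κ * b : 𝓞 K) : K)‖ ≤ ‖φ (a : K)‖ + x ^ κ * ‖φ (b : K)‖ := by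
      push_cast
      rw [map_add, map_mul, map_pow]
      refine (norm_add_le _ _).trans ?_
      rw [norm_mul, norm_pow]
    have h2 : A ≤ A / (θ - 1) * (x - 1) := by
      rw [div_mul_eq_mul_div, le_div_iff₀ (by linarith)]
      exact mul_le_mul_of_nonneg_left (by linarith) hA0.le
    have hxk : 0 ≤ x ^ κ := by positivity
    calc ‖φ ((a + q ^ κ * b : 𝓞 K) : K)‖ ≤ A / (θ - 1) * x ^ κ + x ^ κ * A :=
          h1.trans (add_le_add (ih a ha φ) (mul_le_mul_of_nonneg_left (hdA b hb φ) hxk))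
      _ ≤ A / (θ - 1) * x ^ κ + x ^ κ * (A / (θ - 1) * (x - 1)) := by gcongr
      _ = A / (θ - 1) * x ^ (κ + 1) := by ring

theorem finite_setOf_conj_le (B : ℝ) :
    {c : 𝓞 K | ∀ φ : K →+* ℂ, ‖φ (c : K)‖ ≤ B}.Finite := by
  have h := NumberField.Embeddings.finite_of_norm_le K ℂ B
  refine Set.Finite.of_finite_image (f := fun c : 𝓞 K => (c : K)) (h.subset ?_) ?_
  · rintro _ ⟨c, hc, rfl⟩
    exact ⟨c.isIntegral_coe, hc⟩
  · exact fun a _ b _ h => NumberField.RingOfIntegers.coe_injective h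

/-- There are a finite set of carries and a number of steps within which every carry is absorbed
by some string of digits. -/
theorem IsFNS.exists_carry_set (hqD : IsFNS q D) :
    ∃ (E : Finset (𝓞 K)) (r : ℕ), 0 < r ∧
      (∀ κ, ∀ m ∈ digitSet q D κ, ∀ n ∈ digitSet q D κ, highDigits q D κ (m + n) ∈ E) ∧
      (∀ c ∈ E, ∀ m ∈ digitSet q D r, highDigits q D r (m + c) ∈ E) ∧
      (∀ c ∈ E, c ∈ digitSet q D r) := by
  obtain ⟨θ, B, hθ, hB, hθq, hbd⟩ := hqD.exists_conj_bound
  -- Initial carries are bounded by `3B`. The bound `4B` is stable once `|φ(q)| ^ r ≥ 2`: a new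
  -- carry is at most `2B + 4B / |φ(q)| ^ r`.
  set E := (finite_setOf_conj_le (K := K) (4 * B)).toFinset with hE
  have hmemE : ∀ c, c ∈ E ↔ ∀ φ : K →+* ℂ, ‖φ (c : K)‖ ≤ 4 * B := by simp [hE]
  have key : ∀ (κ : ℕ) (n : 𝓞 K) (φ : K →+* ℂ), ‖φ (highDigits q D κ n : K)‖ * ‖φ (q : K)‖ ^ κ ≤
      ‖φ (n : K)‖ + B * ‖φ (q : K)‖ ^ κ := by
    intro κ n φ
    have h1 : (highDigits q D κ n : K) * (q : K) ^ κ = (n : K) - (lowDigits q D κ n : K) := by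
      have := congrArg (fun x : 𝓞 K => (x : K)) (hqD.lowDigits_add_highDigits κ n)
      simp only [map_add, map_mul, map_pow] at this
      linear_combination -this
    have h2 := congrArg (fun x => ‖φ x‖) h1
    simp only [map_mul, norm_mul, map_pow, norm_pow, map_sub] at h2
    rw [h2]
    exact (norm_sub_le _ _).trans (add_le_add_right (hbd κ _ (hqD.lowDigits_mem κ n) φ) _)
  have hqpos : ∀ (φ : K →+* ℂ) (κ : ℕ), 0 < ‖φ (q : K)‖ ^ κ := fun φ κ =>
    pow_pos (by linarith [hθq φ]) κ
  choose s hs using fun n => hqD.exists_mem_digitSet n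
  obtain ⟨k, hk⟩ := pow_unbounded_of_one_lt 2 hθ
  -- Large enough for `|φ(q)| ^ r ≥ 2` and for `r` digits to hold every element of `E`; the `1`
  -- ensures `r > 0`.
  set r := k + 1 + ∑ c ∈ E, s c with hr
  refine ⟨E, r, by omega, ?_, ?_, ?_⟩
  · intro κ m hm n hn
    rw [hmemE]
    intro φ
    have h1 := key κ (m + n) φ
    have h2 : ‖φ ((m + n : 𝓞 K) : K)‖ ≤ B * ‖φ (q : K)‖ ^ κ + B * ‖φ (q : K)‖ ^ κ := by
      push_cast
      rw [map_add]
      exact (norm_add_le _ _).trans (add_le_add (hbd κ m hm φ) (hbd κ n hn φ))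
    have h3 := hqpos φ κ
    refine le_of_mul_le_mul_right ?_ h3
    nlinarith
  · intro c hc m hm
    rw [hmemE] at hc ⊢
    intro φ
    have h1 := key r (m + c) φ
    have h2 : ‖φ ((m + c : 𝓞 K) : K)‖ ≤ B * ‖φ (q : K)‖ ^ r + 4 * B := by
      push_cast
      rw [map_add]
      exact (norm_add_le _ _).trans (add_le_add (hbd r m hm φ) (hc φ))
    have h3 : 2 ≤ ‖φ (q : K)‖ ^ r := by
      refine hk.le.trans ((pow_le_pow_left₀ (by linarith) (hθq φ) k).trans ?_)
      exact pow_le_pow_right₀ (by linarith [hθq φ]) (by omega)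
    refine le_of_mul_le_mul_right ?_ (hqpos φ r)
    nlinarith
  · intro c hc
    refine hqD.mem_digitSet_of_le ?_ (hs c)
    have : s c ≤ ∑ c ∈ E, s c := Finset.single_le_sum (fun _ _ => Nat.zero_le _) hc
    omega

/-- The number of `m ∈ 𝒩_ρ` for which `m + c` has a digit of index at least `ρ`. -/
def overflowCount (q : 𝓞 K) (D : Finset (𝓞 K)) (ρ : ℕ) (c : 𝓞 K) : ℕ :=
  ((digitSet q D ρ).filter fun m => m + c ∉ digitSet q D ρ).card

theorem IsFNS.add_mul_add_mem_iff (hqD : IsFNS q D) {κ ρ : ℕ} {a b c : 𝓞 K} :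
    a + q ^ κ * b + c ∈ digitSet q D (κ + ρ) ↔
      b + highDigits q D κ (a + c) ∈ digitSet q D ρ := by
  rw [← hqD.highDigits_eq_zero_iff, ← hqD.highDigits_eq_zero_iff, hqD.highDigits_add,
    show a + q ^ κ * b + c = a + c + q ^ κ * b by ring, hqD.highDigits_add_mul, add_comm b]

theorem IsFNS.overflowCount_add (hqD : IsFNS q D) (κ ρ : ℕ) (c : 𝓞 K) :
    overflowCount q D (κ + ρ) c =
      ∑ a ∈ digitSet q D κ, overflowCount q D ρ (highDigits q D κ (a + c)) := by
  unfold overflowCount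
  rw [Finset.card_filter, hqD.sum_digitSet_add]
  refine Finset.sum_congr rfl fun a _ => ?_
  rw [Finset.card_filter]
  refine Finset.sum_congr rfl fun b _ => ?_
  simp only [hqD.add_mul_add_mem_iff]

theorem overflowCount_zero (ρ : ℕ) : overflowCount q D ρ 0 = 0 := by
  simp [overflowCount, Finset.filter_eq_empty_iff]

theorem IsFNS.overflowCount_le (hqD : IsFNS q D) (ρ : ℕ) (c : 𝓞 K) :
    (overflowCount q D ρ c : ℝ) ≤ absNorm q ^ ρ := by
  rw [← hqD.card_digitSet]
  exact_mod_cast Finset.card_filter_le _ _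

/-- Peel off `r` low digits at a time. The zero block absorbs `c`, because `c` itself fits into `r`
digits, and contributes nothing; each of the other `Q ^ r - 1` blocks passes on a carry in `E`. -/
theorem IsFNS.overflowCount_le_pow (hqD : IsFNS q D) {E : Finset (𝓞 K)} {r : ℕ}
    (hE : ∀ c ∈ E, ∀ m ∈ digitSet q D r, highDigits q D r (m + c) ∈ E)
    (hr : ∀ c ∈ E, c ∈ digitSet q D r) (s j : ℕ) {c : 𝓞 K} (hc : c ∈ E) :
    (overflowCount q D (j * r + s) c : ℝ) ≤ (absNorm q ^ r - 1) ^ j * absNorm q ^ s := by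
  induction j generalizing c with
  | zero => simpa using hqD.overflowCount_le s c
  | succ j ih =>
    rw [show (j + 1) * r + s = r + (j * r + s) by ring, hqD.overflowCount_add,
      ← Finset.sum_erase_add _ _ (hqD.zero_mem_digitSet r), zero_add,
      hqD.highDigits_of_mem (hr c hc), overflowCount_zero, add_zero]
    push_cast
    refine (Finset.sum_le_card_nsmul _ _ _ fun m hm =>
      ih (hE c hc m (Finset.mem_of_mem_erase hm))).trans ?_
    rw [nsmul_eq_mul, Finset.card_erase_of_mem (hqD.zero_mem_digitSet r), Nat.cast_sub
      (Finset.card_pos.2 ⟨0, hqD.zero_mem_digitSet r⟩), hqD.card_digitSet, Nat.cast_one, pow_succ]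
    apply le_of_eq
    ring

/-- Cut `m` into `κ`, `ρ` and `l` digits. The high digits can change only if some carry in `E`
leaving the low block runs through the whole middle block; the outer blocks are free. -/
theorem IsFNS.card_carry_le (hqD : IsFNS q D) {E : Finset (𝓞 K)}
    (hE : ∀ κ, ∀ m ∈ digitSet q D κ, ∀ n ∈ digitSet q D κ, highDigits q D κ (m + n) ∈ E)
    (κ ρ l : ℕ) :
    (((digitSet q D (κ + ρ + l)).filter fun m => ∃ n ∈ digitSet q D κ,
        highDigits q D (κ + ρ) (m + n) ≠ highDigits q D (κ + ρ) m).card : ℝ) ≤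
      absNorm q ^ κ * absNorm q ^ l * ∑ c ∈ E, (overflowCount q D ρ c : ℝ) := by
  have h1 : ∀ a ∈ digitSet q D κ, ∀ m ∈ digitSet q D ρ, ∀ b ∈ digitSet q D l,
      (∃ n ∈ digitSet q D κ, highDigits q D (κ + ρ) (a + q ^ κ * m + q ^ (κ + ρ) * b + n) ≠
        highDigits q D (κ + ρ) (a + q ^ κ * m + q ^ (κ + ρ) * b)) →
      ∃ c ∈ E, m + c ∉ digitSet q D ρ := by
    rintro a ha m hm b - ⟨n, hn, h⟩
    refine ⟨highDigits q D κ (a + n), hE κ a ha n hn, fun h' => h ?_⟩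
    rw [← hqD.add_mul_add_mem_iff] at h'
    rw [show a + q ^ κ * m + q ^ (κ + ρ) * b + n = a + q ^ κ * m + n + q ^ (κ + ρ) * b by ring,
      hqD.highDigits_add_mul, hqD.highDigits_add_mul, hqD.highDigits_of_mem h',
      hqD.highDigits_of_mem (mem_digitSet_add.2 ⟨a, ha, m, hm, rfl⟩)]
  have h2 : ((digitSet q D (κ + ρ + l)).filter fun m => ∃ n ∈ digitSet q D κ,
        highDigits q D (κ + ρ) (m + n) ≠ highDigits q D (κ + ρ) m).card ≤
      ∑ a ∈ digitSet q D κ, ∑ m ∈ digitSet q D ρ, ∑ b ∈ digitSet q D l,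
        ∑ c ∈ E, if m + c ∉ digitSet q D ρ then 1 else 0 := by
    rw [Finset.card_filter, hqD.sum_digitSet_add, hqD.sum_digitSet_add]
    refine Finset.sum_le_sum fun a ha => Finset.sum_le_sum fun m hm =>
      Finset.sum_le_sum fun b hb => ?_
    split_ifs with h
    · obtain ⟨c, hc, hcm⟩ := h1 a ha m hm b hb h
      refine le_trans ?_ (Finset.single_le_sum (fun _ _ => Nat.zero_le _) hc)
      rw [if_pos hcm]
    · exact Nat.zero_le _
  have h3 : ∑ a ∈ digitSet q D κ, ∑ m ∈ digitSet q D ρ, ∑ b ∈ digitSet q D l,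
        ∑ c ∈ E, (if m + c ∉ digitSet q D ρ then 1 else 0) =
      (digitSet q D κ).card * ((digitSet q D l).card * ∑ c ∈ E, overflowCount q D ρ c) := by
    rw [Finset.sum_const, smul_eq_mul]
    congr 1
    simp_rw [Finset.sum_const, smul_eq_mul, ← Finset.mul_sum]
    rw [Finset.sum_comm]
    simp_rw [overflowCount, Finset.card_filter]
  rw [h3] at h2
  have h4 : (((digitSet q D (κ + ρ + l)).filter fun m => ∃ n ∈ digitSet q D κ,
        highDigits q D (κ + ρ) (m + n) ≠ highDigits q D (κ + ρ) m).card : ℝ) ≤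
      (digitSet q D κ).card * ((digitSet q D l).card * ∑ c ∈ E, (overflowCount q D ρ c : ℝ)) := by
    exact_mod_cast h2
  rwa [hqD.card_digitSet, hqD.card_digitSet, ← mul_assoc] at h4

theorem IsFNS.exists_isCarryConstant (hqD : IsFNS q D) : ∃ η₂ : ℝ, IsCarryConstant q D η₂ := by
  obtain ⟨E, r, hr0, hE1, hE2, hE3⟩ := hqD.exists_carry_set
  set Q := absNorm q with hQ
  have hQ2 : 2 ≤ Q := hqD.two_le_absNorm
  have hQ0 : 0 < Q := by linarith
  have hQr : 2 ≤ Q ^ r := hQ2.trans (le_self_pow₀ (by linarith) hr0.ne')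
  set P := Q ^ r with hP
  have hlogQ : 0 < Real.log Q := Real.log_pos (by linarith)
  have hr : (0 : ℝ) < r := by exact_mod_cast hr0
  have hlogP : Real.log P = r * Real.log Q := by
    rw [hP, Real.log_pow]
  -- Chosen so that the survival factor of one block is `P - 1 = Q ^ (r (1 - η))`.
  set η := 1 - Real.log (P - 1) / (r * Real.log Q) with hη
  have hPη : P - 1 = Q ^ ((r : ℝ) * (1 - η)) := by
    rw [Real.rpow_def_of_pos hQ0, hη]
    have : Real.log Q * (r * (1 - (1 - Real.log (P - 1) / (r * Real.log Q)))) =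
        Real.log (P - 1) := by
      field_simp
      ring
    rw [this, Real.exp_log (by linarith)]
  have hη0 : 0 < η := by
    rw [hη, sub_pos, div_lt_one (by positivity), ← hlogP]
    exact Real.log_lt_log (by linarith) (by linarith)
  have hη1 : η ≤ 1 := by
    have : 0 ≤ Real.log (P - 1) / (r * Real.log Q) :=
      div_nonneg (Real.log_nonneg (by linarith)) (by positivity)
    linarith
  -- The factor `Q ^ r` pays for the `ρ % r` digits left over by the blocks.
  refine ⟨η, hη0, hη1, E.card * Q ^ r, ?_⟩
  intro ρ ν μ hρν hνμ
  obtain ⟨κ, rfl⟩ := Nat.exists_eq_add_of_le hρν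
  obtain ⟨l, rfl⟩ := Nat.exists_eq_add_of_le hνμ
  have h1 := hqD.card_carry_le hE1 κ ρ l
  rw [Nat.add_sub_cancel_left, add_comm ρ κ]
  refine h1.trans ?_
  have h2 : ∀ c ∈ E, (overflowCount q D ρ c : ℝ) ≤ Q ^ r * Q ^ ((ρ : ℝ) * (1 - η)) := by
    intro c hc
    have h3 := hqD.overflowCount_le_pow hE2 hE3 (ρ % r) (ρ / r) hc
    rw [Nat.div_add_mod'] at h3
    refine h3.trans ?_
    rw [← hQ, ← hP, hPη, mul_comm, ← Real.rpow_natCast (Q ^ ((r : ℝ) * (1 - η))),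
      ← Real.rpow_mul hQ0.le]
    refine mul_le_mul (pow_le_pow_right₀ (by linarith) (Nat.mod_lt _ hr0).le) ?_
      (Real.rpow_nonneg hQ0.le _) (by positivity)
    refine Real.rpow_le_rpow_of_exponent_le (by linarith) ?_
    have h4 : (r : ℝ) * ((ρ / r : ℕ) : ℝ) ≤ ρ := by
      exact_mod_cast Nat.mul_div_le ρ r
    nlinarith
  have h5 := Finset.sum_le_card_nsmul _ _ _ h2
  rw [nsmul_eq_mul] at h5
  refine (mul_le_mul_of_nonneg_left h5 (by positivity)).trans (le_of_eq ?_)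
  rw [← Real.rpow_natCast Q κ, ← Real.rpow_natCast Q l]
  have h6 : ((κ + ρ + l : ℕ) : ℝ) - η * ρ = κ + l + ρ * (1 - η) := by
    push_cast
    ring
  rw [h6, Real.rpow_add hQ0, Real.rpow_add hQ0]
  ring

end Carry

/-! ### Trace characters, Parseval and Bessel inequalities. -/

section Characters

theorem traceChar_add (x y : K) : traceChar (x + y) = traceChar x * traceChar y := by
  unfold traceChar
  rw [← Complex.exp_add, map_add]
  push_cast
  ring_nf

theorem traceChar_zero : traceChar (0 : K) = 1 := by
  simp [traceChar]

theorem norm_traceChar (x : K) : ‖traceChar x‖ = 1 := by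
  have : 2 * (Real.pi : ℂ) * Complex.I * ((Algebra.trace ℚ K x : ℚ) : ℂ) =
      ((2 * Real.pi * ((Algebra.trace ℚ K x : ℚ) : ℝ) : ℝ) : ℂ) * Complex.I := by
    push_cast
    ring
  rw [traceChar, this, Complex.norm_exp_ofReal_mul_I]

theorem star_traceChar (x : K) : star (traceChar x) = traceChar (-x) := by
  have h1 : traceChar x * traceChar (-x) = 1 := by
    rw [← traceChar_add, add_neg_cancel, traceChar_zero]
  have h2 : traceChar x * star (traceChar x) = 1 := by
    have := Complex.mul_conj (traceChar x)
    rw [Complex.normSq_eq_norm_sq, norm_traceChar] at this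
    simpa using this
  have h3 : traceChar x ≠ 0 := by
    rw [← norm_pos_iff, norm_traceChar]
    exact one_pos
  exact mul_left_cancel₀ h3 (h2.trans h1.symm)

theorem traceChar_eq_one_iff (x : K) :
    traceChar x = 1 ↔ ∃ n : ℤ, (n : ℚ) = Algebra.trace ℚ K x := by
  rw [traceChar, Complex.exp_eq_one_iff]
  refine exists_congr fun n => ?_
  have h : 2 * (Real.pi : ℂ) * Complex.I ≠ 0 := Complex.two_pi_I_ne_zero
  rw [mul_comm (n : ℂ), mul_right_inj' h, eq_comm]
  exact_mod_cast Iff.rfl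

theorem mem_traceDual_one_iff (x : K) :
    x ∈ Submodule.traceDual ℤ ℚ (1 : Submodule (𝓞 K) K) ↔
      ∀ n : 𝓞 K, traceChar (x * (n : K)) = 1 := by
  rw [Submodule.mem_traceDual]
  simp only [traceChar_eq_one_iff, Submodule.mem_one, forall_exists_index,
    forall_apply_eq_imp_iff, RingHom.mem_range, Algebra.traceForm_apply]
  rfl

/-- The dual is a fractional ideal: a common denominator `a` embeds the set into the algebraic
integers with bounded conjugates. -/
theorem finite_traceDual_conj_le (B : ℝ) :
    {y : K | y ∈ Submodule.traceDual ℤ ℚ (1 : Submodule (𝓞 K) K) ∧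
      ∀ φ : K →+* ℂ, ‖φ y‖ ≤ B}.Finite := by
  obtain ⟨a, ha, hI⟩ :=
    (FractionalIdeal.dual ℤ ℚ (1 : FractionalIdeal (nonZeroDivisors (𝓞 K)) K)).isFractional
  have ha0 : (a : K) ≠ 0 := by simpa using nonZeroDivisors.ne_zero ha
  rw [FractionalIdeal.coe_dual_one] at hI
  set A : ℝ := ∑ φ : K →+* ℂ, ‖φ (a : K)‖ with hA
  have h := NumberField.Embeddings.finite_of_norm_le K ℂ (A * |B|)
  refine Set.Finite.of_finite_image (f := fun y : K => (a : K) * y) (h.subset ?_) ?_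
  · rintro _ ⟨y, ⟨hy, hyB⟩, rfl⟩
    refine ⟨?_, fun φ => ?_⟩
    · obtain ⟨c, hc⟩ := hI y hy
      rw [Algebra.smul_def] at hc
      change IsIntegral ℤ (algebraMap (𝓞 K) K a * y)
      rw [← hc]
      exact c.isIntegral_coe
    · rw [map_mul, norm_mul]
      have h1 : ‖φ (a : K)‖ ≤ A := Finset.single_le_sum (f := fun φ : K →+* ℂ => ‖φ (a : K)‖)
        (fun _ _ => norm_nonneg _) (Finset.mem_univ φ)
      exact mul_le_mul h1 ((hyB φ).trans (le_abs_self B)) (norm_nonneg _)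
        ((norm_nonneg _).trans h1)
  · exact fun x _ y _ h => mul_left_cancel₀ ha0 h

/-- The additive character `n ↦ e(Tr(t n))` of the ring of integers. -/
def traceAddChar (t : K) : AddChar (𝓞 K) ℂ where
  toFun n := traceChar (t * (n : K))
  map_zero_eq_one' := by simp [traceChar_zero]
  map_add_eq_mul' a b := by simp [mul_add, traceChar_add]

theorem traceAddChar_apply (t : K) (n : 𝓞 K) : traceAddChar t n = traceChar (t * (n : K)) := rfl

/-- On a `ℤ`-basis the values are `e(k_i / N)`, and nondegeneracy of the trace form yields `t` with
`Tr(t b_i) = k_i / N`. -/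
theorem exists_eq_traceChar_of_pow_eq_one {N : ℕ} (hN : N ≠ 0) (ψ : AddChar (𝓞 K) ℂ)
    (hψ : ∀ n, ψ n ^ N = 1) : ∃ t : K, ∀ n : 𝓞 K, ψ n = traceChar (t * (n : K)) := by
  have hprim := Complex.isPrimitiveRoot_exp N hN
  have : NeZero N := ⟨hN⟩
  let b := NumberField.RingOfIntegers.basis K
  have hk : ∀ i, ∃ k : ℕ, Complex.exp (2 * Real.pi * Complex.I / N) ^ k = ψ (b i) := by
    intro i
    obtain ⟨k, -, hk⟩ := hprim.eq_pow_of_pow_eq_one (hψ (b i))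
    exact ⟨k, hk⟩
  choose k hk using hk
  let l : K →ₗ[ℚ] ℚ := (NumberField.integralBasis K).constr ℚ fun i => (k i : ℚ) / N
  let t := ((Algebra.traceForm ℚ K).toDual (traceForm_nondegenerate ℚ K)).symm l
  have ht : ∀ x, Algebra.trace ℚ K (t * x) = l x := fun x =>
    LinearMap.BilinForm.apply_toDual_symm_apply (hB := traceForm_nondegenerate ℚ K) l x
  refine ⟨t, fun n => ?_⟩
  rw [← traceAddChar_apply]
  have hn : n ∈ Submodule.span ℤ (Set.range b) := by
    rw [b.span_eq]
    trivial
  induction hn using Submodule.span_induction with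
  | mem x hx =>
    obtain ⟨i, rfl⟩ := hx
    rw [traceAddChar_apply, traceChar, ht, ← hk i, ← Complex.exp_nat_mul]
    have : l (b i : K) = (k i : ℚ) / N := by
      have h1 : (b i : K) = NumberField.integralBasis K i :=
        (NumberField.integralBasis_apply K i).symm
      rw [h1]
      exact Module.Basis.constr_basis _ _ _ _
    rw [this]
    push_cast
    congr 1
    ring
  | zero => simp
  | add x y _ _ hx hy => rw [AddChar.map_add_eq_mul, AddChar.map_add_eq_mul, hx, hy]
  | smul a x _ hx => rw [AddChar.map_zsmul_eq_zpow, AddChar.map_zsmul_eq_zpow, hx]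

variable {q : 𝓞 K} {D : Finset (𝓞 K)}

/-- `T` represents the group of additive characters of `𝓞 K / (q ^ L)`, an element `t` standing for
the character `n ↦ e(Tr(t n))`. -/
structure IsDualSystem (q : 𝓞 K) (L : ℕ) (T : Finset K) : Prop where
  sum_eq : ∀ n : 𝓞 K, ∑ t ∈ T, traceChar (t * (n : K)) =
    if q ^ L ∣ n then (absNorm q : ℂ) ^ L else 0
  periodic : ∀ t ∈ T, ∀ n : 𝓞 K, traceChar (t * ((q ^ L * n : 𝓞 K) : K)) = 1
  complete : ∀ t : K, (∀ n : 𝓞 K, traceChar (t * ((q ^ L * n : 𝓞 K) : K)) = 1) →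
    ∃ t' ∈ T, ∀ n : 𝓞 K, traceChar (t * (n : K)) = traceChar (t' * (n : K))

/-- Every character of the finite group `𝓞 K / (q ^ L)` has roots of unity as values, hence comes
from a trace; orthogonality is that of a finite abelian group. -/
theorem IsFNS.exists_isDualSystem (hqD : IsFNS q D) (L : ℕ) :
    ∃ T : Finset K, IsDualSystem q L T := by
  let I : Ideal (𝓞 K) := Ideal.span {q ^ L}
  let mk : 𝓞 K →+* 𝓞 K ⧸ I := Ideal.Quotient.mk I
  have : Finite (𝓞 K ⧸ I) := Finite.of_surjective _ (hqD.bijective_mk_digitSet L).2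
  let _ : Fintype (𝓞 K ⧸ I) := Fintype.ofFinite _
  have hmk : ∀ n : 𝓞 K, mk n = 0 ↔ q ^ L ∣ n := fun n => by
    rw [← Ideal.mem_span_singleton]
    exact Ideal.Quotient.eq_zero_iff_mem
  have hex : ∀ ψ : AddChar (𝓞 K ⧸ I) ℂ, ∃ t : K, ∀ n : 𝓞 K, ψ (mk n) = traceChar (t * (n : K)) := by
    intro ψ
    refine exists_eq_traceChar_of_pow_eq_one (N := Fintype.card (𝓞 K ⧸ I)) Fintype.card_ne_zero
      (ψ.compAddMonoidHom mk.toAddMonoidHom) fun n => ?_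
    rw [← AddChar.map_nsmul_eq_pow, AddChar.compAddMonoidHom_apply, map_nsmul, card_nsmul_eq_zero,
      AddChar.map_zero_eq_one]
  choose τ hτ using hex
  have hinj : Function.Injective τ := by
    intro ψ ψ' h
    ext x
    obtain ⟨n, rfl⟩ := Ideal.Quotient.mk_surjective x
    exact (hτ ψ n).trans (by rw [h]; exact (hτ ψ' n).symm)
  refine ⟨Finset.univ.image τ, ?_, ?_, ?_⟩
  · intro n
    rw [Finset.sum_image fun _ _ _ _ h => hinj h]
    simp_rw [← hτ]
    rw [AddChar.sum_apply_eq_ite]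
    simp only [hmk]
    have hc := natCard_quotient (q := q) L
    rw [Nat.card_eq_fintype_card] at hc
    split_ifs
    · exact_mod_cast congrArg (fun x : ℝ => (x : ℂ)) hc
    · rfl
  · intro t ht n
    obtain ⟨ψ, -, rfl⟩ := Finset.mem_image.1 ht
    rw [← hτ, (hmk _).2 (dvd_mul_right _ _), AddChar.map_zero_eq_one]
  · intro t ht
    have hcongr : ∀ m n : 𝓞 K, mk m = mk n → traceChar (t * (m : K)) = traceChar (t * (n : K)) := by
      intro m n h
      rw [← sub_eq_zero, ← map_sub, hmk] at h
      obtain ⟨k, hk⟩ := h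
      have h1 := ht k
      rw [← hk] at h1
      have h2 : t * (m : K) = t * ((m - n : 𝓞 K) : K) + t * (n : K) := by
        push_cast
        ring
      rw [h2, traceChar_add, h1, one_mul]
    have hout : ∀ x : 𝓞 K ⧸ I, mk (Function.surjInv Ideal.Quotient.mk_surjective x) = x :=
      Function.surjInv_eq _
    let ψ : AddChar (𝓞 K ⧸ I) ℂ :=
      { toFun := fun x =>
          traceChar (t * (Function.surjInv Ideal.Quotient.mk_surjective x : 𝓞 K))
        map_zero_eq_one' := by
          rw [hcongr _ 0 (by rw [hout, map_zero])]
          simp [traceChar_zero]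
        map_add_eq_mul' := fun x y => by
          rw [hcongr _ (Function.surjInv Ideal.Quotient.mk_surjective x +
            Function.surjInv Ideal.Quotient.mk_surjective y) (by
              rw [map_add, hout, hout, hout]), ← traceChar_add]
          push_cast
          rw [mul_add] }
    refine ⟨τ ψ, Finset.mem_image_of_mem _ (Finset.mem_univ _), fun n => ?_⟩
    rw [← hτ]
    exact hcongr _ _ (hout (mk n)).symm

theorem IsDualSystem.card_eq {L : ℕ} {T : Finset K} (hT : IsDualSystem q L T) :
    (T.card : ℝ) = absNorm q ^ L := by
  have h := hT.sum_eq 0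
  simp only [map_zero, mul_zero, traceChar_zero, Finset.sum_const, nsmul_eq_mul, mul_one,
    dvd_zero, if_true] at h
  exact_mod_cast h

theorem sq_norm_sum_traceChar (S : Finset (𝓞 K)) (a : 𝓞 K → ℂ) (t : K) :
    ((‖∑ n ∈ S, a n * traceChar (t * (n : K))‖ ^ 2 : ℝ) : ℂ) =
      ∑ n ∈ S, ∑ m ∈ S, a n * star (a m) * traceChar (t * ((n - m : 𝓞 K) : K)) := by
  rw [← Complex.normSq_eq_norm_sq, ← Complex.mul_conj, map_sum, Finset.sum_mul_sum]
  refine Finset.sum_congr rfl fun n _ => Finset.sum_congr rfl fun m _ => ?_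
  have h1 : (starRingEnd ℂ) (a m * traceChar (t * (m : K))) =
      star (a m) * traceChar (-(t * (m : K))) := by
    rw [map_mul, ← star_traceChar]
    rfl
  have h2 : t * ((n - m : 𝓞 K) : K) = t * (n : K) + -(t * (m : K)) := by
    push_cast
    ring
  rw [h1, h2, traceChar_add]
  ring

theorem IsFNS.parseval (hqD : IsFNS q D) {L : ℕ} {T : Finset K} (hT : IsDualSystem q L T)
    (a : 𝓞 K → ℂ) :
    ∑ t ∈ T, ‖∑ n ∈ digitSet q D L, a n * traceChar (t * (n : K))‖ ^ 2 =
      absNorm q ^ L * ∑ n ∈ digitSet q D L, ‖a n‖ ^ 2 := by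
  apply Complex.ofReal_injective
  rw [Complex.ofReal_sum]
  simp_rw [sq_norm_sum_traceChar]
  rw [Finset.sum_comm, Complex.ofReal_mul, Complex.ofReal_sum, Finset.mul_sum]
  refine Finset.sum_congr rfl fun n hn => ?_
  rw [Finset.sum_comm]
  simp_rw [← Finset.mul_sum, hT.sum_eq]
  rw [Finset.sum_eq_single n]
  · simp only [sub_self, dvd_zero, if_true]
    have : a n * star (a n) = ((‖a n‖ ^ 2 : ℝ) : ℂ) := by
      rw [← Complex.normSq_eq_norm_sq, ← Complex.mul_conj]
      rfl
    rw [this]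
    push_cast
    ring
  · intro m hm hmn
    rw [if_neg fun h => hmn (hqD.eq_of_dvd_sub hn hm h).symm, mul_zero]
  · exact fun h => absurd hn h

/-- Parseval's inequality for frequencies of bounded multiplicity modulo `q ^ L`. -/
theorem IsFNS.sum_sq_norm_le_of_multiplicity (hqD : IsFNS q D) {ι : Type*} {L : ℕ} (H : Finset ι)
    (x : ι → K) (hx : ∀ h ∈ H, ∀ n : 𝓞 K, traceChar (x h * ((q ^ L * n : 𝓞 K) : K)) = 1) (m : ℕ)
    (hm : ∀ h₀ ∈ H, (H.filter fun h =>
      ∀ n : 𝓞 K, traceChar (x h * (n : K)) = traceChar (x h₀ * (n : K))).card ≤ m)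
    (a : 𝓞 K → ℂ) :
    ∑ h ∈ H, ‖∑ n ∈ digitSet q D L, a n * traceChar (x h * (n : K))‖ ^ 2 ≤
      m * (absNorm q ^ L * ∑ n ∈ digitSet q D L, ‖a n‖ ^ 2) := by
  obtain ⟨T, hT⟩ := hqD.exists_isDualSystem L
  have hex : ∀ h, ∃ t : K, h ∈ H →
      t ∈ T ∧ ∀ n : 𝓞 K, traceChar (x h * (n : K)) = traceChar (t * (n : K)) := by
    intro h
    by_cases hh : h ∈ H
    · obtain ⟨t, ht⟩ := hT.complete (x h) (hx h hh)
      exact ⟨t, fun _ => ht⟩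
    · exact ⟨0, fun h' => absurd h' hh⟩
  choose τ hτ using hex
  have h1 : ∑ h ∈ H, ‖∑ n ∈ digitSet q D L, a n * traceChar (x h * (n : K))‖ ^ 2 =
      ∑ h ∈ H, ‖∑ n ∈ digitSet q D L, a n * traceChar (τ h * (n : K))‖ ^ 2 := by
    refine Finset.sum_congr rfl fun h hh => ?_
    simp_rw [(hτ h hh).2]
  rw [h1, ← hqD.parseval hT a, Finset.mul_sum,
    ← Finset.sum_fiberwise_of_maps_to (fun h hh => (hτ h hh).1)]
  refine Finset.sum_le_sum fun t _ => ?_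
  rw [Finset.sum_congr rfl (g := fun _ =>
    ‖∑ n ∈ digitSet q D L, a n * traceChar (t * (n : K))‖ ^ 2) (fun h hh => by
      rw [(Finset.mem_filter.1 hh).2]), Finset.sum_const, nsmul_eq_mul]
  refine mul_le_mul_of_nonneg_right ?_ (by positivity)
  rcases (H.filter fun h => τ h = t).eq_empty_or_nonempty with h | ⟨h₀, h₀mem⟩
  · rw [h]
    simp
  · obtain ⟨h₀H, h₀t⟩ := Finset.mem_filter.1 h₀mem
    refine Nat.cast_le.2 ((Finset.card_le_card fun h hh => ?_).trans (hm h₀ h₀H))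
    obtain ⟨hH, ht⟩ := Finset.mem_filter.1 hh
    refine Finset.mem_filter.2 ⟨hH, fun n => ?_⟩
    rw [(hτ h hH).2, (hτ h₀ h₀H).2, ht, h₀t]

end Characters

/-! ### Geometry of the frequency set. -/

section Frequencies

variable {q : 𝓞 K} {D : Finset (𝓞 K)}

/-- Equivalence of norms in finite dimension: a definite seminorm is continuous and has a positive
minimum on the compact unit sphere. -/
theorem exists_norm_le_mul_seminorm {ι : Type*} [Fintype ι] (nrm : Seminorm ℝ (ι → ℝ))
    (hnrm : ∀ x, nrm x = 0 → x = 0) : ∃ B : ℝ, 0 < B ∧ ∀ x, ‖x‖ ≤ B * nrm x := by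
  set A : ℝ := ∑ i, nrm (Pi.single i 1) with hA
  have hle : ∀ x, nrm x ≤ A * ‖x‖ := by
    intro x
    have h1 : x = ∑ i, x i • Pi.single (M := fun _ => ℝ) i 1 := by
      ext j
      simp [Finset.sum_apply, Pi.single_apply]
    have h2 : nrm (∑ i, x i • Pi.single (M := fun _ => ℝ) i 1) ≤
        ∑ i, nrm (x i • Pi.single (M := fun _ => ℝ) i 1) :=
      Finset.le_sum_of_subadditive nrm (map_zero nrm).le (map_add_le_add nrm) _ _
    rw [← h1] at h2
    refine h2.trans ?_
    rw [hA, Finset.sum_mul]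
    refine Finset.sum_le_sum fun i _ => ?_
    rw [map_smul_eq_mul, mul_comm]
    exact mul_le_mul_of_nonneg_left (norm_le_pi_norm x i) (apply_nonneg _ _)
  have hcont : Continuous nrm := by
    refine (LipschitzWith.of_dist_le_mul (K := A.toNNReal) fun x y => ?_).continuous
    rw [Real.coe_toNNReal _ (Finset.sum_nonneg fun i _ => apply_nonneg _ _), Real.dist_eq,
      dist_eq_norm]
    exact (abs_sub_map_le_sub nrm x y).trans (hle _)
  rcases isEmpty_or_nonempty ι with hι | hι
  · refine ⟨1, one_pos, fun x => ?_⟩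
    rw [Subsingleton.elim x 0]
    simp
  obtain ⟨z, hz, hmin⟩ := (isCompact_sphere (0 : ι → ℝ) 1).exists_isMinOn
    (NormedSpace.sphere_nonempty.2 zero_le_one) hcont.continuousOn
  have hz0 : 0 < nrm z := by
    refine lt_of_le_of_ne (apply_nonneg _ _) fun h => ?_
    have := hnrm z h.symm
    rw [this] at hz
    simp at hz
  refine ⟨(nrm z)⁻¹, inv_pos.2 hz0, fun x => ?_⟩
  rcases eq_or_ne x 0 with rfl | hx
  · simp
  have hx0 : 0 < ‖x‖ := norm_pos_iff.2 hx
  have h1 : nrm z ≤ nrm (‖x‖⁻¹ • x) := hmin (by simp [norm_smul, hx0.ne'])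
  rw [map_smul_eq_mul, norm_inv, norm_norm] at h1
  rw [inv_mul_eq_div, le_div_iff₀ hz0]
  calc ‖x‖ * nrm z ≤ ‖x‖ * (‖x‖⁻¹ * nrm x) := mul_le_mul_of_nonneg_left h1 hx0.le
    _ = nrm x := by field_simp

theorem exists_conj_le_of_seminorm_le {ι : Type*} [Fintype ι] (ω : Module.Basis ι ℤ (𝓞 K))
    (nrm : Seminorm ℝ (ι → ℝ)) (hnrm : ∀ x, nrm x = 0 → x = 0) :
    ∃ B : ℝ, 0 < B ∧ ∀ x : K, nrm (coords ω x) ≤ 1 → ∀ φ : K →+* ℂ, ‖φ x‖ ≤ B := by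
  obtain ⟨A, hA, hle⟩ := exists_norm_le_mul_seminorm nrm hnrm
  set b := ω.localizationLocalization ℚ (nonZeroDivisors ℤ) K with hb
  refine ⟨1 + A * ∑ φ : K →+* ℂ, ∑ i, ‖φ (b i)‖, by positivity, fun x hx φ => ?_⟩
  have h1 : ∀ i, ‖coords ω x i‖ ≤ A := fun i =>
    (norm_le_pi_norm _ i).trans ((hle _).trans (mul_le_of_le_one_right hA.le hx))
  have h2 : φ x = ∑ i, (coords ω x i : ℂ) * φ (b i) := by
    conv_lhs => rw [← b.sum_repr x]
    rw [map_sum]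
    refine Finset.sum_congr rfl fun i _ => ?_
    rw [Algebra.smul_def, map_mul, eq_ratCast, map_ratCast]
    simp [coords, hb]
  have h3 : ‖φ x‖ ≤ A * ∑ i, ‖φ (b i)‖ := by
    rw [h2, Finset.mul_sum]
    refine (norm_sum_le _ _).trans (Finset.sum_le_sum fun i _ => ?_)
    rw [norm_mul, Complex.norm_real]
    exact mul_le_mul_of_nonneg_right (h1 i) (norm_nonneg _)
  have h4 : ∑ i, ‖φ (b i)‖ ≤ ∑ φ : K →+* ℂ, ∑ i, ‖φ (b i)‖ :=
    Finset.single_le_sum (f := fun φ : K →+* ℂ => ∑ i, ‖φ (b i)‖)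
      (fun _ _ => by positivity) (Finset.mem_univ φ)
  nlinarith [mul_le_mul_of_nonneg_left h4 hA.le]

theorem finite_frequencySet {ι : Type*} [Fintype ι] (ω : Module.Basis ι ℤ (𝓞 K))
    (nrm : Seminorm ℝ (ι → ℝ)) (hnrm : ∀ x, nrm x = 0 → x = 0) (hqD : IsFNS q D) (k : ℕ) :
    (frequencySet ω nrm q k).Finite := by
  obtain ⟨B, hB, hle⟩ := exists_conj_le_of_seminorm_le ω nrm hnrm
  refine (finite_traceDual_conj_le (B * ∑ φ : K →+* ℂ, ‖φ (q : K)‖ ^ k)).subset ?_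
  rintro h ⟨hd, hn⟩
  refine ⟨hd, fun φ => ?_⟩
  have h1 : h = h / (q : K) ^ k * (q : K) ^ k :=
    (div_mul_cancel₀ _ (pow_ne_zero _ hqD.coe_ne_zero)).symm
  rw [h1, map_mul, map_pow, norm_mul, norm_pow]
  exact mul_le_mul (hle _ hn φ) (Finset.single_le_sum
    (f := fun φ : K →+* ℂ => ‖φ (q : K)‖ ^ k) (fun _ _ => by positivity) (Finset.mem_univ φ))
    (by positivity) hB.le

/-- If `h` and `h₀` give the same character, testing it on multiples of `q ^ l` shows that `(h - h₀)
/ q ^ k` lies in the trace dual. Its conjugates are at most `2B`, so the multiplicity is bounded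
independently of `k` and `l`. -/
theorem exists_frequencySet_bessel {ι : Type*} [Fintype ι] (ω : Module.Basis ι ℤ (𝓞 K))
    (nrm : Seminorm ℝ (ι → ℝ)) (hnrm : ∀ x, nrm x = 0 → x = 0) (hqD : IsFNS q D) :
    ∃ m : ℕ, ∀ (k l : ℕ) (H : Finset K), (∀ h ∈ H, h ∈ frequencySet ω nrm q k) →
      ∀ a : 𝓞 K → ℂ,
      ∑ h ∈ H, ‖∑ n ∈ digitSet q D (l + k),
          a n * traceChar (-(h / (q : K) ^ (l + k)) * (n : K))‖ ^ 2 ≤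
        m * (absNorm q ^ (l + k) * ∑ n ∈ digitSet q D (l + k), ‖a n‖ ^ 2) := by
  obtain ⟨B, hB, hle⟩ := exists_conj_le_of_seminorm_le ω nrm hnrm
  set Y := (finite_traceDual_conj_le (K := K) (2 * B)).toFinset with hY
  refine ⟨Y.card, fun k l H hH a => ?_⟩
  have hq := hqD.coe_ne_zero
  refine hqD.sum_sq_norm_le_of_multiplicity H (fun h => -(h / (q : K) ^ (l + k))) ?_ _ ?_ a
  · intro h hh n
    have h1 := (mem_traceDual_one_iff h).1 (hH h hh).1 (-n)
    rw [← h1]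
    congr 1
    push_cast
    field_simp
  · intro h₀ hh₀
    refine Finset.card_le_card_of_injOn (fun h => (h - h₀) / (q : K) ^ k) ?_ ?_
    · intro h hh
      obtain ⟨hhH, hh⟩ := Finset.mem_filter.1 hh
      rw [hY, Finset.mem_coe, Set.Finite.mem_toFinset]
      refine ⟨?_, fun φ => ?_⟩
      · rw [mem_traceDual_one_iff]
        intro n
        have h1 := hh (-(q ^ l * n))
        have h2 : (h - h₀) / (q : K) ^ k * (n : K) =
            -(h / (q : K) ^ (l + k)) * ((-(q ^ l * n) : 𝓞 K) : K) +
              -(-(h₀ / (q : K) ^ (l + k)) * ((-(q ^ l * n) : 𝓞 K) : K)) := by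
          push_cast
          field_simp
          ring
        rw [h2, traceChar_add, h1, ← traceChar_add, add_neg_cancel, traceChar_zero]
      · change ‖φ ((h - h₀) / (q : K) ^ k)‖ ≤ 2 * B
        rw [sub_div, map_sub]
        refine (norm_sub_le _ _).trans ?_
        linarith [hle _ (hH h hhH).2 φ, hle _ (hH h₀ hh₀).2 φ]
    · intro h _ h' _ hhh
      have := (div_left_inj' (pow_ne_zero k hq)).1 hhh
      exact sub_left_injective this

theorem norm_traceChar_sub_one_le (x : K) :
    ‖traceChar x - 1‖ ≤ 2 * Real.pi * ∑ φ : K →ₐ[ℚ] ℂ, ‖φ x‖ := by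
  have h1 : traceChar x = Complex.exp (Complex.I *
      ((2 * Real.pi * ((Algebra.trace ℚ K x : ℚ) : ℝ) : ℝ) : ℂ)) := by
    rw [traceChar]
    congr 1
    push_cast
    ring
  rw [h1]
  refine (Real.norm_exp_I_mul_ofReal_sub_one_le).trans ?_
  rw [norm_mul, Real.norm_of_nonneg (by positivity : (0 : ℝ) ≤ 2 * Real.pi)]
  refine mul_le_mul_of_nonneg_left ?_ (by positivity)
  have h2 := trace_eq_sum_embeddings (K := ℚ) (L := K) ℂ (x := x)
  have h3 : ‖((Algebra.trace ℚ K x : ℚ) : ℝ)‖ = ‖∑ φ : K →ₐ[ℚ] ℂ, φ x‖ := by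
    rw [← h2, eq_ratCast, ← Complex.norm_real]
    simp
  rw [h3]
  exact norm_sum_le _ _

/-- Characters of small frequency are nearly constant on short digit blocks. -/
theorem exists_le_norm_sum_traceChar {ι : Type*} [Fintype ι] (ω : Module.Basis ι ℤ (𝓞 K))
    (nrm : Seminorm ℝ (ι → ℝ)) (hnrm : ∀ x, nrm x = 0 → x = 0) (hqD : IsFNS q D) :
    ∃ r : ℕ, ∀ k l M : ℕ, M + r ≤ l → ∀ h ∈ frequencySet ω nrm q k,
      absNorm q ^ M / 2 ≤
        ‖∑ s ∈ digitSet q D M, traceChar (h / (q : K) ^ (l + k) * (s : K))‖ := by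
  obtain ⟨B, hB, hle⟩ := exists_conj_le_of_seminorm_le ω nrm hnrm
  obtain ⟨θ, A, hθ, hA, hθq, hbd⟩ := hqD.exists_conj_bound
  set d : ℝ := ((Finset.univ : Finset (K →ₐ[ℚ] ℂ)).card : ℝ) with hd
  -- The conjugates of `h s / q ^ (l + k)` are at most `B A / θ ^ r`; this `r` makes each character
  -- value lie within `1 / 2` of 1.
  obtain ⟨r, hr⟩ := pow_unbounded_of_one_lt (2 * (2 * Real.pi * (d * (B * A)))) hθ
  refine ⟨r, fun k l M hM h hh => ?_⟩
  have hsmall : ∀ s ∈ digitSet q D M, ‖traceChar (h / (q : K) ^ (l + k) * (s : K)) - 1‖ ≤ 1 / 2 := by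
    intro s hs
    refine (norm_traceChar_sub_one_le _).trans ?_
    have h1 : ∀ φ : K →ₐ[ℚ] ℂ, ‖φ (h / (q : K) ^ (l + k) * (s : K))‖ ≤ B * A / θ ^ r := by
      intro φ
      have h2 : h / (q : K) ^ (l + k) * (s : K) = h / (q : K) ^ k * (s : K) / (q : K) ^ l := by
        have := hqD.coe_ne_zero
        field_simp
        ring
      have h3 := hle _ hh.2 φ.toRingHom
      have h4 := hbd M s hs φ.toRingHom
      have h5 := hθq φ.toRingHom
      change ‖φ _‖ ≤ _ at h3
      change ‖φ _‖ ≤ _ * ‖φ _‖ ^ _ at h4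
      change _ ≤ ‖φ _‖ at h5
      set y := ‖φ (q : K)‖ with hy
      have hy1 : 1 ≤ y := by linarith
      have hy0 : 0 < y := by linarith
      rw [h2, map_div₀, map_mul, map_pow, norm_div, norm_mul, norm_pow, ← hy]
      rw [div_le_div_iff₀ (by positivity) (by positivity)]
      calc ‖φ (h / (q : K) ^ k)‖ * ‖φ (s : K)‖ * θ ^ r ≤ B * (A * y ^ M) * y ^ r := by
            gcongr
        _ = B * A * y ^ (M + r) := by rw [pow_add]; ring
        _ ≤ B * A * y ^ l := by gcongr
    have h6 := Finset.sum_le_card_nsmul Finset.univ _ _ (fun φ _ => h1 φ)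
    rw [nsmul_eq_mul, ← hd] at h6
    have hθr : 0 < θ ^ r := by positivity
    calc 2 * Real.pi * ∑ φ : K →ₐ[ℚ] ℂ, ‖φ (h / (q : K) ^ (l + k) * (s : K))‖
        ≤ 2 * Real.pi * (d * (B * A / θ ^ r)) := by gcongr
      _ = 2 * Real.pi * (d * (B * A)) / θ ^ r := by ring
      _ ≤ 1 / 2 := by
        rw [div_le_iff₀ hθr]
        linarith
  have h1 : ‖∑ s ∈ digitSet q D M, (traceChar (h / (q : K) ^ (l + k) * (s : K)) - 1)‖ ≤
      absNorm q ^ M * (1 / 2) := by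
    rw [← hqD.card_digitSet, ← nsmul_eq_mul]
    exact (norm_sum_le _ _).trans (Finset.sum_le_card_nsmul _ _ _ hsmall)
  rw [Finset.sum_sub_distrib, Finset.sum_const, nsmul_eq_mul, mul_one] at h1
  have h2 : ‖((digitSet q D M).card : ℂ)‖ = absNorm q ^ M := by
    rw [← hqD.card_digitSet]
    simp
  have h3 := norm_sub_norm_le ((digitSet q D M).card : ℂ)
    (∑ s ∈ digitSet q D M, traceChar (h / (q : K) ^ (l + k) * (s : K)))
  rw [norm_sub_rev, h2] at h3
  linarith

end Frequencies

/-! ### Smoothing over digit blocks. -/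

section BlockEstimate

variable {q : 𝓞 K} {D : Finset (𝓞 K)}

theorem sq_norm_sum_le_card_mul {α : Type*} (S : Finset α) (z : α → ℂ) :
    ‖∑ s ∈ S, z s‖ ^ 2 ≤ S.card * ∑ s ∈ S, ‖z s‖ ^ 2 :=
  (pow_le_pow_left₀ (norm_nonneg _) (norm_sum_le _ _) 2).trans sq_sum_le_card_mul_sum_sq

theorem IsFNS.norm_sum_le_of_norm_one (hqD : IsFNS q D) {F : 𝓞 K → ℂ} (hF : ∀ n, ‖F n‖ = 1)
    (M : ℕ) (p : 𝓞 K → 𝓞 K) : ‖∑ s ∈ digitSet q D M, F (p s)‖ ^ 2 ≤ absNorm q ^ (2 * M) := by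
  rw [mul_comm, pow_mul]
  refine pow_le_pow_left₀ (norm_nonneg _) ((norm_sum_le _ _).trans ?_) 2
  simp [hF, hqD.card_digitSet]

/-- Sums of `F` over the translates of a digit block are small in the mean when `F` has small
Fourier coefficients. -/
theorem IsFNS.sum_sq_norm_block_le (hqD : IsFNS q D) {L M : ℕ} (hML : M ≤ L) (F : 𝓞 K → ℂ) {X : ℝ}
    (hX : ∀ t : K, ‖∑ n ∈ digitSet q D L, F n * traceChar (t * (n : K))‖ ≤ X) :
    ∑ n ∈ digitSet q D L, ‖∑ s ∈ digitSet q D M, F (lowDigits q D L (n + s))‖ ^ 2 ≤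
      X ^ 2 * absNorm q ^ M := by
  obtain ⟨T, hT⟩ := hqD.exists_isDualSystem L
  have hQL : 0 < absNorm q ^ L := pow_pos hqD.absNorm_pos L
  refine le_of_mul_le_mul_left ?_ hQL
  rw [← hqD.parseval hT]
  -- The block sum is a convolution modulo `q ^ L`, so its transform factors. One factor is bounded
  -- by `X`; the other is, up to conjugation, the transform of the indicator of `𝒩_M`, whose mean
  -- square is again known by Parseval.
  have h1 : ∀ t ∈ T, ∑ n ∈ digitSet q D L,
      (∑ s ∈ digitSet q D M, F (lowDigits q D L (n + s))) * traceChar (t * (n : K)) =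
      (∑ s ∈ digitSet q D M, traceChar (-(t * (s : K)))) *
        ∑ n ∈ digitSet q D L, F n * traceChar (t * (n : K)) := by
    intro t ht
    simp_rw [Finset.sum_mul]
    rw [Finset.sum_comm]
    refine Finset.sum_congr rfl fun s _ => ?_
    rw [← hqD.sum_lowDigits_add L s (fun n => F n * traceChar (t * (n : K))), Finset.mul_sum]
    refine Finset.sum_congr rfl fun n _ => ?_
    obtain ⟨k, hk⟩ := (hqD.lowDigits_spec L (n + s)).2
    have h2 := hT.periodic t ht k
    rw [← hk] at h2
    have h3 : t * (n : K) = -(t * (s : K)) + t * (lowDigits q D L (n + s) : K) +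
        t * ((n + s - lowDigits q D L (n + s) : 𝓞 K) : K) := by
      push_cast
      ring
    rw [h3, traceChar_add, traceChar_add, h2]
    ring
  have h2 : ∀ t ∈ T, ‖∑ n ∈ digitSet q D L,
      (∑ s ∈ digitSet q D M, F (lowDigits q D L (n + s))) * traceChar (t * (n : K))‖ ^ 2 ≤
      X ^ 2 * ‖∑ n ∈ digitSet q D L,
        (if n ∈ digitSet q D M then (1 : ℂ) else 0) * traceChar (t * (n : K))‖ ^ 2 := by
    intro t ht
    have h3 : ‖∑ s ∈ digitSet q D M, traceChar (-(t * (s : K)))‖ = ‖∑ n ∈ digitSet q D L,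
        (if n ∈ digitSet q D M then (1 : ℂ) else 0) * traceChar (t * (n : K))‖ := by
      simp_rw [← star_traceChar]
      rw [← star_sum, norm_star]
      simp_rw [ite_mul, one_mul, zero_mul]
      rw [← Finset.sum_filter]
      congr 2
      ext n
      rw [Finset.mem_filter]
      exact ⟨fun h => ⟨hqD.mem_digitSet_of_le hML h, h⟩, fun h => h.2⟩
    rw [h1 t ht, norm_mul, mul_pow, h3, mul_comm]
    exact mul_le_mul_of_nonneg_right (pow_le_pow_left₀ (norm_nonneg _) (hX t) 2) (by positivity)
  refine (Finset.sum_le_sum h2).trans ?_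
  rw [← Finset.mul_sum, hqD.parseval hT]
  have h4 : ∑ n ∈ digitSet q D L, ‖(if n ∈ digitSet q D M then (1 : ℂ) else 0)‖ ^ 2 =
      absNorm q ^ M := by
    have h5 : ∀ n, ‖(if n ∈ digitSet q D M then (1 : ℂ) else 0)‖ ^ 2 =
        if n ∈ digitSet q D M then (1 : ℝ) else 0 := by
      intro n
      split_ifs <;> simp
    simp_rw [h5]
    rw [← Finset.sum_filter, Finset.sum_const, nsmul_eq_mul, mul_one, ← hqD.card_digitSet]
    congr 2
    ext n
    rw [Finset.mem_filter]
    exact ⟨fun h => h.2, fun h => ⟨hqD.mem_digitSet_of_le hML h, h⟩⟩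
  rw [h4]
  apply le_of_eq
  ring

/-- No element of `𝒩_M` added to `n` produces a carry out of the first `l` digits. -/
def NoCarry (q : 𝓞 K) (D : Finset (𝓞 K)) (l M : ℕ) (n : 𝓞 K) : Prop :=
  ∀ s ∈ digitSet q D M, n + s ∈ digitSet q D l

/-- For `w` in the first `l` digits, `F(w + q ^ l v) / F(q ^ l v)` depends only on the first `ρ`
digits of `v`. -/
def IsLocalAt (q : 𝓞 K) (D : Finset (𝓞 K)) (F : 𝓞 K → ℂ) (l ρ : ℕ) (v : 𝓞 K) : Prop :=
  ∀ w ∈ digitSet q D l, F (w + q ^ l * v) * star (F (q ^ l * v)) =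
    F (w + q ^ l * lowDigits q D ρ v) * star (F (q ^ l * lowDigits q D ρ v))

theorem IsFNS.sum_comp_lowDigits (hqD : IsFNS q D) {ρ k : ℕ} (h : ρ ≤ k) (F : 𝓞 K → ℝ) :
    ∑ v ∈ digitSet q D k, F (lowDigits q D ρ v) =
      absNorm q ^ (k - ρ) * ∑ v ∈ digitSet q D ρ, F v := by
  obtain ⟨j, rfl⟩ := Nat.exists_eq_add_of_le h
  rw [hqD.sum_digitSet_add, Nat.add_sub_cancel_left, Finset.mul_sum]
  refine Finset.sum_congr rfl fun a ha => ?_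
  rw [← hqD.card_digitSet, ← nsmul_eq_mul, ← Finset.sum_const]
  refine Finset.sum_congr rfl fun b _ => ?_
  rw [hqD.lowDigits_eq ha ⟨b, by ring⟩]

/-- Exceptional `v` are bounded trivially. For the others the block sum depends in modulus only on
`ρ` digits of `v`, so each value recurs `Q ^ (k - ρ)` times and Parseval is applied at the shorter
length `l + ρ`. -/
theorem IsFNS.sum_sq_norm_noCarry_block_le (hqD : IsFNS q D) {l k ρ M : ℕ} (hρ : ρ ≤ k)
    (hM : M ≤ l) {F : 𝓞 K → ℂ} (hF : ∀ n, ‖F n‖ = 1) {X₁ X₃ : ℝ}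
    (h₁ : (((digitSet q D k).filter fun v => ¬ IsLocalAt q D F l ρ v).card : ℝ) ≤ X₁)
    (h₃ : ∀ t : K, ‖∑ n ∈ digitSet q D (l + ρ), F n * traceChar (t * (n : K))‖ ≤ X₃) :
    ∑ n ∈ digitSet q D (l + k), ‖if NoCarry q D l M (lowDigits q D l n) then
        ∑ s ∈ digitSet q D M, F (n + s) else 0‖ ^ 2 ≤
      absNorm q ^ l * absNorm q ^ (2 * M) * X₁ +
        absNorm q ^ (k - ρ) * (X₃ ^ 2 * absNorm q ^ M) := by
  set Q := absNorm q with hQ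
  have hQ0 : 0 < Q := hqD.absNorm_pos
  set G : 𝓞 K → 𝓞 K → ℝ := fun a v =>
    ‖if NoCarry q D l M a then ∑ s ∈ digitSet q D M, F (a + q ^ l * v + s) else 0‖ ^ 2 with hG
  have hGnonneg : ∀ a v, 0 ≤ G a v := fun a v => by positivity
  have hGle : ∀ a v, G a v ≤ Q ^ (2 * M) := by
    intro a v
    simp only [hG]
    split_ifs
    · exact hqD.norm_sum_le_of_norm_one hF M fun s => a + q ^ l * v + s
    · simp only [norm_zero, ne_eq, OfNat.ofNat_ne_zero, not_false_eq_true, zero_pow]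
      positivity
  -- Without a carry `a + s` stays in `𝒩_l`, so locality applies to every term, with one unimodular
  -- factor common to all `s`.
  have hGlocal : ∀ a v, IsLocalAt q D F l ρ v → G a v = G a (lowDigits q D ρ v) := by
    intro a v hv
    simp only [hG]
    split_ifs with ha
    · have hunit : ∀ n, star (F n) * F n = 1 := by
        intro n
        have := Complex.conj_mul' (F n)
        rw [hF] at this
        simpa using this
      have h4 : ∀ s ∈ digitSet q D M, F (a + q ^ l * v + s) =
          F (a + q ^ l * lowDigits q D ρ v + s) *
            (star (F (q ^ l * lowDigits q D ρ v)) * F (q ^ l * v)) := by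
        intro s hs
        have h5 := hv (a + s) (ha s hs)
        rw [show a + s + q ^ l * v = a + q ^ l * v + s by ring,
          show a + s + q ^ l * lowDigits q D ρ v = a + q ^ l * lowDigits q D ρ v + s by ring] at h5
        rw [← mul_assoc, ← h5, mul_assoc, hunit, mul_one]
      rw [Finset.sum_congr rfl h4, ← Finset.sum_mul, norm_mul, norm_mul, norm_star, hF, hF]
      simp
    · rfl
  rw [hqD.sum_digitSet_add]
  have h5 : ∀ a ∈ digitSet q D l, ∀ v ∈ digitSet q D k,
      ‖if NoCarry q D l M (lowDigits q D l (a + q ^ l * v)) then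
        ∑ s ∈ digitSet q D M, F (a + q ^ l * v + s) else 0‖ ^ 2 ≤
      (if ¬ IsLocalAt q D F l ρ v then Q ^ (2 * M) else 0) + G a (lowDigits q D ρ v) := by
    intro a ha v _
    rw [hqD.lowDigits_eq ha ⟨v, by ring⟩]
    change G a v ≤ _
    split_ifs with hv
    · rw [zero_add, hGlocal a v hv]
    · exact (hGle a v).trans (le_add_of_nonneg_right (hGnonneg _ _))
  refine (Finset.sum_le_sum fun a ha => Finset.sum_le_sum fun v hv => h5 a ha v hv).trans ?_
  simp_rw [Finset.sum_add_distrib]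
  refine add_le_add ?_ ?_
  · rw [Finset.sum_const, nsmul_eq_mul, hqD.card_digitSet, ← Finset.sum_filter, Finset.sum_const,
      nsmul_eq_mul, mul_assoc, mul_comm _ (Q ^ (2 * M))]
    gcongr
  · simp_rw [hqD.sum_comp_lowDigits hρ]
    rw [← Finset.mul_sum]
    refine mul_le_mul_of_nonneg_left ?_ (by positivity)
    refine le_trans ?_ (hqD.sum_sq_norm_block_le (hM.trans (Nat.le_add_right l ρ)) F h₃)
    rw [hqD.sum_digitSet_add]
    refine Finset.sum_le_sum fun a _ => Finset.sum_le_sum fun v hv => ?_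
    simp only [hG]
    split_ifs with ha
    · apply le_of_eq
      congr 2
      refine Finset.sum_congr rfl fun s hs => ?_
      rw [hqD.lowDigits_of_mem]
      exact mem_digitSet_add.2 ⟨a + s, ha s hs, v, hv, by ring⟩
    · simp only [norm_zero, ne_eq, OfNat.ofNat_ne_zero, not_false_eq_true, zero_pow]
      positivity

/-- In the absence of a carry the shift alters only the first `l` digits and so stays inside
`𝒩_{l+k}`; no periodicity of `F` is needed. -/
theorem IsFNS.sum_noCarry_shift (hqD : IsFNS q D) {l k M : ℕ} {s : 𝓞 K}
    (hs : s ∈ digitSet q D M) (F : 𝓞 K → ℂ) (x : K) :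
    ∑ n ∈ digitSet q D (l + k), (if NoCarry q D l M (lowDigits q D l (n - s)) then F n else 0) *
        traceChar (-x * ((n - s : 𝓞 K) : K)) =
      ∑ n ∈ digitSet q D (l + k), (if NoCarry q D l M (lowDigits q D l n) then F (n + s) else 0) *
        traceChar (-x * (n : K)) := by
  simp_rw [ite_mul, zero_mul]
  rw [← Finset.sum_filter, ← Finset.sum_filter]
  refine Finset.sum_bij' (fun n _ => n - s) (fun n _ => n + s) ?_ ?_ ?_ ?_ ?_
  · intro n hn
    obtain ⟨hn, hc⟩ := Finset.mem_filter.1 hn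
    obtain ⟨a, ha, b, hb, rfl⟩ := mem_digitSet_add.1 hn
    have h1 : lowDigits q D l (a + q ^ l * b - s) + s = a := by
      refine hqD.eq_of_dvd_sub (hc s hs) ha ?_
      have h2 := (hqD.lowDigits_spec l (a + q ^ l * b - s)).2
      have h3 := dvd_sub (dvd_mul_right (q ^ l) b) h2
      convert h3 using 1
      ring
    refine Finset.mem_filter.2 ⟨?_, hc⟩
    refine mem_digitSet_add.2 ⟨_, hqD.lowDigits_mem l (a + q ^ l * b - s), b, hb, ?_⟩
    linear_combination h1
  · intro n hn
    obtain ⟨hn, hc⟩ := Finset.mem_filter.1 hn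
    obtain ⟨a, ha, b, hb, rfl⟩ := mem_digitSet_add.1 hn
    refine Finset.mem_filter.2 ⟨?_, by rwa [add_sub_cancel_right]⟩
    rw [hqD.lowDigits_eq ha ⟨b, by ring⟩] at hc
    exact mem_digitSet_add.2 ⟨a + s, hc s hs, b, hb, by ring⟩
  · intro n _
    ring
  · intro n _
    ring
  · intro n _
    rw [sub_add_cancel]

theorem IsFNS.card_carry_shift (hqD : IsFNS q D) (l k M : ℕ) {F : 𝓞 K → ℂ}
    (hF : ∀ n, ‖F n‖ = 1) (s : 𝓞 K) :
    ∑ n ∈ digitSet q D (l + k),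
        ‖if NoCarry q D l M (lowDigits q D l (n - s)) then 0 else F n‖ ^ 2 =
      absNorm q ^ k * ((digitSet q D l).filter fun n => ¬ NoCarry q D l M n).card := by
  have h1 : ∀ n, ‖if NoCarry q D l M (lowDigits q D l (n - s)) then 0 else F n‖ ^ 2 =
      if ¬ NoCarry q D l M (lowDigits q D l (n - s)) then (1 : ℝ) else 0 := by
    intro n
    by_cases h : NoCarry q D l M (lowDigits q D l (n - s)) <;> simp [h, hF]
  simp_rw [h1]
  rw [hqD.sum_digitSet_add, Finset.card_filter]
  push_cast
  rw [← hqD.sum_lowDigits_add l (-s) (fun n => if ¬ NoCarry q D l M n then (1 : ℝ) else 0),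
    Finset.mul_sum]
  refine Finset.sum_congr rfl fun a _ => ?_
  rw [← hqD.card_digitSet, ← nsmul_eq_mul, ← Finset.sum_const]
  refine Finset.sum_congr rfl fun b _ => ?_
  rw [hqD.lowDigits_congr (m := a + -s) (n := a + q ^ l * b - s) ⟨b, by ring⟩]

/-- Mean square estimate of the exponential sums of `F` over a set of frequencies on which the
characters are nearly constant on blocks of length `M`. -/
theorem IsFNS.sum_sq_norm_frequencies_le (hqD : IsFNS q D) {l k ρ M m : ℕ} (hρ : ρ ≤ k)
    (hM : M ≤ l) {F : 𝓞 K → ℂ} (hF : ∀ n, ‖F n‖ = 1) (H : Finset K) (x : K → K)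
    (hbessel : ∀ a : 𝓞 K → ℂ,
      ∑ h ∈ H, ‖∑ n ∈ digitSet q D (l + k), a n * traceChar (-(x h) * (n : K))‖ ^ 2 ≤
        m * (absNorm q ^ (l + k) * ∑ n ∈ digitSet q D (l + k), ‖a n‖ ^ 2))
    (hblock : ∀ h ∈ H,
      absNorm q ^ M / 2 ≤ ‖∑ s ∈ digitSet q D M, traceChar (x h * (s : K))‖) {X₁ X₂ X₃ : ℝ}
    (h₁ : (((digitSet q D k).filter fun v => ¬ IsLocalAt q D F l ρ v).card : ℝ) ≤ X₁)
    (h₂ : (((digitSet q D l).filter fun n => ¬ NoCarry q D l M n).card : ℝ) ≤ X₂)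
    (h₃ : ∀ t : K, ‖∑ n ∈ digitSet q D (l + ρ), F n * traceChar (t * (n : K))‖ ≤ X₃) :
    absNorm q ^ (2 * M) *
        ∑ h ∈ H, ‖∑ n ∈ digitSet q D (l + k), F n * traceChar (-(x h) * (n : K))‖ ^ 2 ≤
      8 * (m * (absNorm q ^ (l + k) * (absNorm q ^ l * absNorm q ^ (2 * M) * X₁ +
        absNorm q ^ (k - ρ) * (X₃ ^ 2 * absNorm q ^ M) +
        absNorm q ^ k * absNorm q ^ (2 * M) * X₂))) := by
  set Q := absNorm q with hQ
  have hQ0 : 0 < Q := hqD.absNorm_pos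
  set a : 𝓞 K → ℂ := fun n => if NoCarry q D l M (lowDigits q D l n) then
        ∑ s ∈ digitSet q D M, F (n + s) else 0 with ha
  set b : 𝓞 K → 𝓞 K → ℂ := fun s n =>
    if NoCarry q D l M (lowDigits q D l (n - s)) then 0 else F n with hb
  -- Expand the product over pairs `(s, n)`: the pairs for which `n - s` admits no carry are shifted
  -- and form the block sums `a`; the rest is collected in `b s`.
  have hsplit : ∀ y : K,
      (∑ s ∈ digitSet q D M, traceChar (y * (s : K))) *
        ∑ n ∈ digitSet q D (l + k), F n * traceChar (-y * (n : K)) =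
      ∑ n ∈ digitSet q D (l + k), a n * traceChar (-y * (n : K)) +
      ∑ s ∈ digitSet q D M, traceChar (y * (s : K)) *
        ∑ n ∈ digitSet q D (l + k), b s n * traceChar (-y * (n : K)) := by
    intro y
    have h4 : ∑ n ∈ digitSet q D (l + k), a n * traceChar (-y * (n : K)) =
        ∑ s ∈ digitSet q D M, ∑ n ∈ digitSet q D (l + k),
          (if NoCarry q D l M (lowDigits q D l n) then F (n + s) else 0) *
            traceChar (-y * (n : K)) := by
      rw [Finset.sum_comm]
      refine Finset.sum_congr rfl fun n _ => ?_
      rw [← Finset.sum_mul]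
      simp only [ha]
      split_ifs <;> simp
    rw [h4, ← Finset.sum_add_distrib, Finset.sum_mul]
    refine Finset.sum_congr rfl fun s hs => ?_
    rw [← hqD.sum_noCarry_shift hs, Finset.mul_sum, Finset.mul_sum, ← Finset.sum_add_distrib]
    refine Finset.sum_congr rfl fun n _ => ?_
    have h5 : traceChar (-y * ((n - s : 𝓞 K) : K)) =
        traceChar (y * (s : K)) * traceChar (-y * (n : K)) := by
      rw [← traceChar_add]
      congr 1
      push_cast
      ring
    rw [h5]
    simp only [hb]
    split_ifs <;> ring
  -- `8 = 4 · 2`: the lower bound `Q ^ M / 2` squared, and `‖U + V‖² ≤ 2(‖U‖² + ‖V‖²)`.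
  have hpoint : ∀ h ∈ H, Q ^ (2 * M) *
      ‖∑ n ∈ digitSet q D (l + k), F n * traceChar (-(x h) * (n : K))‖ ^ 2 ≤
      8 * (‖∑ n ∈ digitSet q D (l + k), a n * traceChar (-(x h) * (n : K))‖ ^ 2 +
        Q ^ M * ∑ s ∈ digitSet q D M,
          ‖∑ n ∈ digitSet q D (l + k), b s n * traceChar (-(x h) * (n : K))‖ ^ 2) := by
    intro h hh
    have h6 := congrArg norm (hsplit (x h))
    rw [norm_mul] at h6
    set A := ‖∑ s ∈ digitSet q D M, traceChar (x h * (s : K))‖ with hA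
    set S := ‖∑ n ∈ digitSet q D (l + k), F n * traceChar (-(x h) * (n : K))‖ with hS
    have h7 : (Q ^ M / 2) ^ 2 * S ^ 2 ≤ (A * S) ^ 2 := by
      rw [mul_pow]
      exact mul_le_mul_of_nonneg_right (pow_le_pow_left₀ (by positivity) (hblock h hh) 2)
        (by positivity)
    rw [h6] at h7
    set U := ∑ n ∈ digitSet q D (l + k), a n * traceChar (-(x h) * (n : K)) with hU
    set V := ∑ s ∈ digitSet q D M, traceChar (x h * (s : K)) *
        ∑ n ∈ digitSet q D (l + k), b s n * traceChar (-(x h) * (n : K)) with hV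
    have h8 : ‖U + V‖ ^ 2 ≤ 2 * (‖U‖ ^ 2 + ‖V‖ ^ 2) :=
      (pow_le_pow_left₀ (norm_nonneg _) (norm_add_le _ _) 2).trans add_sq_le
    have h9 : ‖V‖ ^ 2 ≤ Q ^ M * ∑ s ∈ digitSet q D M,
        ‖∑ n ∈ digitSet q D (l + k), b s n * traceChar (-(x h) * (n : K))‖ ^ 2 := by
      have := sq_norm_sum_le_card_mul (digitSet q D M) fun s => traceChar (x h * (s : K)) *
        ∑ n ∈ digitSet q D (l + k), b s n * traceChar (-(x h) * (n : K))
      simpa only [norm_mul, norm_traceChar, one_mul, hqD.card_digitSet] using this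
    have h10 : (Q ^ M / 2) ^ 2 = Q ^ (2 * M) / 4 := by
      rw [div_pow, ← pow_mul, mul_comm M 2]
      norm_num
    rw [h10] at h7
    linarith
  rw [Finset.mul_sum]
  refine (Finset.sum_le_sum hpoint).trans ?_
  rw [← Finset.mul_sum]
  refine mul_le_mul_of_nonneg_left ?_ (by norm_num)
  rw [Finset.sum_add_distrib, ← Finset.mul_sum, Finset.sum_comm, mul_add (Q ^ (l + k)), mul_add]
  refine add_le_add ?_ ?_
  · refine (hbessel a).trans ?_
    refine mul_le_mul_of_nonneg_left (mul_le_mul_of_nonneg_left ?_ (by positivity))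
      (by positivity)
    exact hqD.sum_sq_norm_noCarry_block_le hρ hM hF h₁ h₃
  · have h4 : ∀ s ∈ digitSet q D M, ∑ h ∈ H,
        ‖∑ n ∈ digitSet q D (l + k), b s n * traceChar (-(x h) * (n : K))‖ ^ 2 ≤
        m * (Q ^ (l + k) * (Q ^ k * X₂)) := by
      intro s _
      refine (hbessel (b s)).trans ?_
      refine mul_le_mul_of_nonneg_left (mul_le_mul_of_nonneg_left ?_ (by positivity))
        (by positivity)
      simp only [hb]
      rw [hqD.card_carry_shift l k M hF s]
      exact mul_le_mul_of_nonneg_left h₂ (by positivity)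
    have h5 := Finset.sum_le_card_nsmul _ _ _ h4
    rw [nsmul_eq_mul, hqD.card_digitSet] at h5
    refine (mul_le_mul_of_nonneg_left h5 (by positivity)).trans (le_of_eq ?_)
    rw [two_mul M, pow_add Q M M]
    ring

end BlockEstimate

/-! ### Digital hypotheses inserted, block lengths optimized. -/

section MainEstimate

variable {q : 𝓞 K} {D : Finset (𝓞 K)}

theorem IsFNS.card_not_noCarry_le (hqD : IsFNS q D) {η₂ C₀ : ℝ}
    (hC₀ : ∀ ρ ν μ : ℕ, ρ ≤ ν → ν ≤ μ →
      (((digitSet q D μ).filter fun m => ∃ n ∈ digitSet q D (ν - ρ),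
        highDigits q D ν (m + n) ≠ highDigits q D ν m).card : ℝ)
      ≤ C₀ * absNorm q ^ ((μ : ℝ) - η₂ * (ρ : ℝ))) {l ρ : ℕ} (hρ : ρ ≤ l) :
    (((digitSet q D l).filter fun n => ¬ NoCarry q D l (l - ρ) n).card : ℝ) ≤
      C₀ * absNorm q ^ ((l : ℝ) - η₂ * (ρ : ℝ)) := by
  refine le_trans (Nat.cast_le.2 (Finset.card_le_card fun n hn => ?_)) (hC₀ ρ l l hρ le_rfl)
  obtain ⟨hn, hc⟩ := Finset.mem_filter.1 hn
  refine Finset.mem_filter.2 ⟨hn, ?_⟩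
  unfold NoCarry at hc
  push Not at hc
  obtain ⟨s, hs, hns⟩ := hc
  refine ⟨s, hs, fun h => hns ?_⟩
  rw [hqD.highDigits_of_mem hn] at h
  exact hqD.highDigits_eq_zero_iff.1 h

/-- The Carry property at level `μ₀ + l` with `u₁ = 0` and `u₂ = q ^ μ₀ w`: truncation at `μ₀ + l +
ρ` keeps exactly the first `ρ` digits of `v`. -/
theorem IsFNS.card_not_isLocalAt_le (hqD : IsFNS q D) {f : 𝓞 K → ℂ} {η₁ C₁ : ℝ}
    (hf : CarryProperty q D f η₁ C₁) (μ₀ l : ℕ) {k ρ : ℕ} (hρ : ρ ≤ k) :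
    (((digitSet q D k).filter fun v =>
        ¬ IsLocalAt q D (fun n => f (q ^ μ₀ * n)) l ρ v).card : ℝ) ≤
      C₁ * absNorm q ^ ((k : ℝ) - η₁ * (ρ : ℝ)) := by
  refine le_trans (Nat.cast_le.2 (Finset.card_le_card fun v hv => ?_)) (hf.2 (μ₀ + l) k ρ hρ)
  obtain ⟨hv, hc⟩ := Finset.mem_filter.1 hv
  refine Finset.mem_filter.2 ⟨hv, 0, hqD.zero_mem_digitSet _, ?_⟩
  unfold IsLocalAt at hc
  push Not at hc
  obtain ⟨w, hw, hne⟩ := hc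
  refine ⟨q ^ μ₀ * w, hqD.pow_mul_mem hw, ?_⟩
  have hlow : ∀ w ∈ digitSet q D l, lowDigits q D (μ₀ + l + ρ)
      (q ^ μ₀ * w + v * q ^ (μ₀ + l)) = q ^ μ₀ * (w + q ^ l * lowDigits q D ρ v) := by
    intro w hw
    refine hqD.lowDigits_eq ?_ ?_
    · rw [add_assoc]
      exact hqD.pow_mul_mem (mem_digitSet_add.2 ⟨w, hw, _, hqD.lowDigits_mem ρ v, rfl⟩)
    · obtain ⟨j, hj⟩ := (hqD.lowDigits_spec ρ v).2
      refine ⟨j, ?_⟩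
      rw [pow_add _ _ ρ, mul_assoc, ← hj, pow_add]
      ring
  have hlow0 := hlow 0 (hqD.zero_mem_digitSet l)
  rw [mul_zero, zero_add] at hlow0
  rw [zero_add, zero_add, truncate, truncate, hlow w hw, hlow0, zero_add]
  have e1 : q ^ μ₀ * w + v * q ^ (μ₀ + l) = q ^ μ₀ * (w + q ^ l * v) := by
    rw [pow_add]
    ring
  have e2 : v * q ^ (μ₀ + l) = q ^ μ₀ * (q ^ l * v) := by
    rw [pow_add]
    ring
  rw [e1, e2]
  exact hne

/-- A character contributes `e(Tr(t w))` to the quotient, whatever `v` is. This is what makes the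
estimates uniform in the twist. -/
theorem IsLocalAt.mul_traceChar {F : 𝓞 K → ℂ} {l ρ : ℕ} {v : 𝓞 K} (hF : IsLocalAt q D F l ρ v)
    (t : K) : IsLocalAt q D (fun n => F n * traceChar (t * (n : K))) l ρ v := by
  have key : ∀ w n : 𝓞 K, F (w + n) * traceChar (t * ((w + n : 𝓞 K) : K)) *
      star (F n * traceChar (t * (n : K))) = F (w + n) * star (F n) * traceChar (t * (w : K)) := by
    intro w n
    rw [star_mul', star_traceChar]
    have h : traceChar (t * ((w + n : 𝓞 K) : K)) * traceChar (-(t * (n : K))) =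
        traceChar (t * (w : K)) := by
      rw [← traceChar_add]
      congr 1
      push_cast
      ring
    rw [← h]
    ring
  intro w hw
  simp only [key, hF w hw]

/-- By Parseval a unimodular function has a Fourier coefficient of size at least `Q ^ (l / 2)`, so
`γ(l)` exceeds `l / 2` by at most a constant. The level `κ = 0` satisfies any range condition. -/
theorem IsFNS.rpow_two_mul_rate_le (hqD : IsFNS q D) {f : 𝓞 K → ℂ} (hf1 : ∀ n, ‖f n‖ = 1)
    {γ : ℕ → ℝ} {c C₂ : ℝ} (hf : FourierProperty q D f γ c C₂) (l : ℕ) :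
    absNorm q ^ (2 * γ l) ≤ C₂ ^ 2 * absNorm q ^ (l : ℝ) := by
  obtain ⟨-, -, hc, hf⟩ := hf
  set Q := absNorm q with hQ
  have hQ0 : 0 < Q := hqD.absNorm_pos
  obtain ⟨T, hT⟩ := hqD.exists_isDualSystem l
  have h1 := hqD.parseval hT f
  have h2 : ∀ t ∈ T, ‖∑ n ∈ digitSet q D l, f n * traceChar (t * (n : K))‖ ^ 2 ≤
      (C₂ * Q ^ ((l : ℝ) - γ l)) ^ 2 := by
    intro t _
    have := hf l 0 t (by simp only [CharP.cast_eq_zero]; positivity)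
    simp only [pow_zero, mul_one] at this
    exact pow_le_pow_left₀ (norm_nonneg _) this 2
  have h3 := Finset.sum_le_card_nsmul _ _ _ h2
  rw [h1, nsmul_eq_mul, hT.card_eq] at h3
  have h4 := le_of_mul_le_mul_left h3 (by positivity)
  simp only [hf1, one_pow, Finset.sum_const, nsmul_eq_mul, mul_one, hqD.card_digitSet] at h4
  rw [← Real.rpow_natCast, mul_pow, ← Real.rpow_mul_natCast hQ0.le] at h4
  have h5 := mul_le_mul_of_nonneg_right h4 (Real.rpow_nonneg hQ0.le (2 * γ l - l))
  rw [← hQ, mul_assoc, ← Real.rpow_add hQ0, ← Real.rpow_add hQ0] at h5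
  have e1 : (l : ℝ) + (2 * γ l - l) = 2 * γ l := by ring
  have e2 : ((l : ℝ) - γ l) * ((2 : ℕ) : ℝ) + (2 * γ l - l) = l := by
    push_cast
    ring
  rwa [e1, e2] at h5

theorem FourierProperty.const_nonneg {f : 𝓞 K → ℂ} {γ : ℕ → ℝ} {c C₂ : ℝ} (hqD : IsFNS q D)
    (hf : FourierProperty q D f γ c C₂) : 0 ≤ C₂ := by
  have h := (norm_nonneg _).trans (hf.2.2.2 0 0 0 (by simp))
  exact nonneg_of_mul_nonneg_left h (Real.rpow_pos_of_pos hqD.absNorm_pos _)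

theorem CarryProperty.const_nonneg {f : 𝓞 K → ℂ} {η₁ C₁ : ℝ} (hqD : IsFNS q D)
    (hf : CarryProperty q D f η₁ C₁) : 0 ≤ C₁ := by
  have h := (Nat.cast_nonneg _).trans (hf.2 0 0 0 le_rfl)
  exact nonneg_of_mul_nonneg_left h (Real.rpow_pos_of_pos hqD.absNorm_pos _)

/-- The estimate of the mean square over the frequencies, with free block lengths. -/
theorem IsFNS.sum_sq_norm_frequencies_le_rpow (hqD : IsFNS q D) {η₂ C₀ : ℝ}
    (hC₀ : ∀ ρ ν μ : ℕ, ρ ≤ ν → ν ≤ μ →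
      (((digitSet q D μ).filter fun m => ∃ n ∈ digitSet q D (ν - ρ),
        highDigits q D ν (m + n) ≠ highDigits q D ν m).card : ℝ)
      ≤ C₀ * absNorm q ^ ((μ : ℝ) - η₂ * (ρ : ℝ)))
    {f : 𝓞 K → ℂ} (hf1 : ∀ n, ‖f n‖ = 1) {η₁ c C₁ C₂ : ℝ} {γ : ℕ → ℝ}
    (hcarry : CarryProperty q D f η₁ C₁) (hfour : FourierProperty q D f γ c C₂)
    {μ₀ l k ρ₁ ρ₂ m : ℕ} (hl : (μ₀ : ℝ) ≤ c * l) (hρ₁ : ρ₁ ≤ k) (hρ₂ : ρ₂ ≤ l)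
    (H : Finset K) (x : K → K)
    (hbessel : ∀ a : 𝓞 K → ℂ,
      ∑ h ∈ H, ‖∑ n ∈ digitSet q D (l + k), a n * traceChar (-(x h) * (n : K))‖ ^ 2 ≤
        m * (absNorm q ^ (l + k) * ∑ n ∈ digitSet q D (l + k), ‖a n‖ ^ 2))
    (hblock : ∀ h ∈ H, absNorm q ^ (l - ρ₂) / 2 ≤
      ‖∑ s ∈ digitSet q D (l - ρ₂), traceChar (x h * (s : K))‖) (t : K) :
    ∑ h ∈ H, ‖∑ n ∈ digitSet q D (l + k),
        f (q ^ μ₀ * n) * traceChar (-(x h + t) * (n : K))‖ ^ 2 ≤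
      8 * m * absNorm q ^ (2 * (l + k)) * (C₁ * absNorm q ^ (-(η₁ * ρ₁)) +
        C₀ * absNorm q ^ (-(η₂ * ρ₂)) + C₂ ^ 2 * absNorm q ^ (ρ₁ + ρ₂ - 2 * γ l)) := by
  set Q := absNorm q with hQ
  have hQ1 : 1 < Q := hqD.one_lt_absNorm
  have hQ0 : 0 < Q := hqD.absNorm_pos
  have hC2 := hfour.const_nonneg hqD
  set F : 𝓞 K → ℂ := fun n => f (q ^ μ₀ * n) * traceChar (-t * (n : K)) with hFdef
  have hF : ∀ n, ‖F n‖ = 1 := fun n => by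
    simp only [hFdef, norm_mul, hf1, norm_traceChar, one_mul]
  have h₁ : (((digitSet q D k).filter fun v => ¬ IsLocalAt q D F l ρ₁ v).card : ℝ) ≤
      C₁ * Q ^ ((k : ℝ) - η₁ * (ρ₁ : ℝ)) := by
    refine le_trans (Nat.cast_le.2 (Finset.card_le_card fun v hv => ?_))
      (hqD.card_not_isLocalAt_le hcarry μ₀ l hρ₁)
    obtain ⟨hv, hc⟩ := Finset.mem_filter.1 hv
    exact Finset.mem_filter.2 ⟨hv, fun h => hc (h.mul_traceChar (-t))⟩
  -- The longer length `l + ρ₁` remains in the admissible range, and monotonicity gives `γ(l) ≤ γ(l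
  -- + ρ₁)`.
  have h₃ : ∀ s : K, ‖∑ n ∈ digitSet q D (l + ρ₁), F n * traceChar (s * (n : K))‖ ≤
      C₂ * Q ^ ((l : ℝ) + ρ₁ - γ l) := by
    intro s
    have h4 : (μ₀ : ℝ) ≤ c * ((l + ρ₁ : ℕ) : ℝ) := by
      refine hl.trans (mul_le_mul_of_nonneg_left ?_ hfour.2.2.1.le)
      exact_mod_cast Nat.le_add_right l ρ₁
    have h5 := hfour.2.2.2 (l + ρ₁) μ₀ (-t + s) h4
    have h6 : ∑ n ∈ digitSet q D (l + ρ₁), F n * traceChar (s * (n : K)) =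
        ∑ v ∈ digitSet q D (l + ρ₁), f (v * q ^ μ₀) * traceChar ((-t + s) * (v : K)) := by
      refine Finset.sum_congr rfl fun n _ => ?_
      rw [add_mul, traceChar_add, mul_comm n]
      simp only [hFdef]
      ring
    rw [h6]
    refine h5.trans (mul_le_mul_of_nonneg_left ?_ hC2)
    refine Real.rpow_le_rpow_of_exponent_le hQ1.le ?_
    have := hfour.1 (Nat.le_add_right l ρ₁)
    push_cast
    linarith
  have main := hqD.sum_sq_norm_frequencies_le hρ₁ (Nat.sub_le l ρ₂) hF H x hbessel hblock h₁
    (hqD.card_not_noCarry_le hC₀ hρ₂) h₃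
  have h7 : ∀ h, ∑ n ∈ digitSet q D (l + k), F n * traceChar (-(x h) * (n : K)) =
      ∑ n ∈ digitSet q D (l + k), f (q ^ μ₀ * n) * traceChar (-(x h + t) * (n : K)) := by
    intro h
    refine Finset.sum_congr rfl fun n _ => ?_
    rw [show -(x h + t) * (n : K) = -t * (n : K) + -(x h) * (n : K) by ring, traceChar_add]
    simp only [hFdef]
    ring
  simp_rw [h7] at main
  refine le_of_mul_le_mul_left (main.trans (le_of_eq ?_)) (pow_pos hQ0 (2 * (l - ρ₂)))
  obtain ⟨M, rfl⟩ := Nat.exists_eq_add_of_le hρ₂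
  obtain ⟨j, rfl⟩ := Nat.exists_eq_add_of_le hρ₁
  rw [Nat.add_sub_cancel_left, Nat.add_sub_cancel_left]
  have e1 : Q ^ (((ρ₁ + j : ℕ) : ℝ) - η₁ * ρ₁) = Q ^ ρ₁ * Q ^ j * Q ^ (-(η₁ * ρ₁)) := by
    rw [← pow_add, ← Real.rpow_natCast, ← Real.rpow_add hQ0]
    ring_nf
  have e2 : Q ^ (((ρ₂ + M : ℕ) : ℝ) - η₂ * ρ₂) = Q ^ ρ₂ * Q ^ M * Q ^ (-(η₂ * ρ₂)) := by
    rw [← pow_add, ← Real.rpow_natCast, ← Real.rpow_add hQ0]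
    ring_nf
  have e3 : (Q ^ (((ρ₂ + M : ℕ) : ℝ) + ρ₁ - γ (ρ₂ + M))) ^ 2 =
      Q ^ ρ₂ * Q ^ M * Q ^ M * Q ^ ρ₁ * Q ^ ((ρ₁ : ℝ) + ρ₂ - 2 * γ (ρ₂ + M)) := by
    rw [← Real.rpow_mul_natCast hQ0.le, ← pow_add, ← pow_add, ← pow_add, ← Real.rpow_natCast,
      ← Real.rpow_add hQ0]
    congr 1
    push_cast
    ring
  rw [← hQ, e1, e2, mul_pow, e3]
  ring

/-- The last inequality is the balancing condition: block lengths `ηγ / η₁` and `ηγ / η₂` must leave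
a saving `ηγ` out of `2γ`. -/
theorem rate_bounds {η₁ η₂ : ℝ} (h₁ : 0 < η₁) (h₂ : 0 < η₂) :
    0 < 2 * η₁ * η₂ / ((2 + η₁) * (1 + η₂)) ∧
    2 * η₁ * η₂ / ((2 + η₁) * (1 + η₂)) ≤ 2 * η₂ ∧
    2 * η₁ * η₂ / ((2 + η₁) * (1 + η₂)) / η₁ + 2 * η₁ * η₂ / ((2 + η₁) * (1 + η₂)) / η₂ +
      2 * η₁ * η₂ / ((2 + η₁) * (1 + η₂)) ≤ 2 := by
  refine ⟨by positivity, ?_, ?_⟩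
  · rw [div_le_iff₀ (by positivity)]
    nlinarith [mul_pos h₁ h₂, mul_pos (mul_pos h₁ h₂) h₂, mul_pos h₂ h₂]
  · have : 2 * η₁ * η₂ / ((2 + η₁) * (1 + η₂)) / η₁ + 2 * η₁ * η₂ / ((2 + η₁) * (1 + η₂)) / η₂ +
        2 * η₁ * η₂ / ((2 + η₁) * (1 + η₂)) =
        (2 * η₂ + 2 * η₁ + 2 * η₁ * η₂) / ((2 + η₁) * (1 + η₂)) := by
      field_simp
    rw [this, div_le_iff₀ (by positivity)]
    nlinarith [mul_pos h₁ h₂]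

/-- Choice of the block lengths. -/
theorem exists_block_lengths {Q : ℝ} (hQ : 1 < Q) {η₁ η₂ η C₂ g : ℝ} (h₁ : 0 < η₁) (h₂ : 0 < η₂)
    (h₂' : η₂ ≤ 1) (hη : 0 < η) (hη2 : η ≤ 2 * η₂) (hηsum : η / η₁ + η / η₂ + η ≤ 2)
    (hg : 0 ≤ g) {l k r : ℕ} (hr : r ≤ l) (hl : Q ^ (2 * g) ≤ C₂ ^ 2 * Q ^ (l : ℝ)) :
    ∃ ρ₁ ρ₂ : ℕ, ρ₁ ≤ k ∧ ρ₂ ≤ l ∧ r ≤ ρ₂ ∧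
      Q ^ (-(η₁ * ρ₁)) ≤ Q ^ (-(η * g)) + Q ^ (-(η₁ * k)) ∧
      Q ^ (-(η₂ * ρ₂)) ≤ (1 + C₂ ^ 2) * Q ^ (-(η * g)) ∧
      Q ^ (ρ₁ + ρ₂ - 2 * g) ≤ Q ^ (r + 2) * Q ^ (-(η * g)) := by
  have hQ0 : 0 < Q := by linarith
  have hpow : ∀ y : ℝ, 0 < Q ^ y := fun y => Real.rpow_pos_of_pos hQ0 y
  have hmono : ∀ {y z : ℝ}, y ≤ z → Q ^ y ≤ Q ^ z := fun h =>
    Real.rpow_le_rpow_of_exponent_le hQ.le h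
  have hc1 : 0 ≤ η * g / η₁ := by positivity
  have hc2 : 0 ≤ η * g / η₂ := by positivity
  -- Lengths that make the two carry errors `Q ^ (-ηg)`, capped by the available digits. The cap at
  -- `k` is the source of the term `Q ^ (-η₁ k)`; the summand `r` leaves room for the near-constancy
  -- of the characters.
  refine ⟨min k ⌈η * g / η₁⌉₊, min l (r + ⌈η * g / η₂⌉₊), min_le_left _ _, min_le_left _ _,
    le_min hr (Nat.le_add_right _ _), ?_, ?_, ?_⟩
  · rcases min_choice k ⌈η * g / η₁⌉₊ with h | h <;> rw [h]
    · exact le_add_of_nonneg_left (hpow _).le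
    · refine le_add_of_le_of_nonneg (hmono ?_) (hpow _).le
      have := Nat.le_ceil (η * g / η₁)
      rw [div_le_iff₀ h₁] at this
      linarith
  · have hge : Q ^ (-(η * g)) ≤ (1 + C₂ ^ 2) * Q ^ (-(η * g)) :=
      le_mul_of_one_le_left (hpow _).le (by nlinarith [sq_nonneg C₂])
    rcases min_choice l (r + ⌈η * g / η₂⌉₊) with h | h <;> rw [h]
    -- The cap at `l` is harmless, because `hl` says that `2g` exceeds `l` by at most a constant;
    -- `η₂ ≤ 1` keeps that constant below `1 + C₂ ^ 2`.
    · have h3 : Q ^ (2 * g - l) ≤ C₂ ^ 2 := by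
        rw [Real.rpow_sub hQ0, div_le_iff₀ (hpow _)]
        exact hl
      have h4 : Q ^ (η₂ * (2 * g - l)) ≤ 1 + C₂ ^ 2 := by
        rw [mul_comm, Real.rpow_mul hQ0.le]
        refine (Real.rpow_le_rpow (hpow _).le (h3.trans (le_add_of_nonneg_left zero_le_one))
          h₂.le).trans ?_
        refine (Real.rpow_le_rpow_of_exponent_le ?_ h₂').trans (Real.rpow_one _).le
        nlinarith [sq_nonneg C₂]
      calc Q ^ (-(η₂ * (l : ℝ))) = Q ^ (η₂ * (2 * g - l)) * Q ^ (-(2 * η₂ * g)) := by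
            rw [← Real.rpow_add hQ0]
            ring_nf
        _ ≤ (1 + C₂ ^ 2) * Q ^ (-(η * g)) := by
            refine mul_le_mul h4 (hmono ?_) (hpow _).le (by positivity)
            nlinarith
    · refine le_trans (hmono ?_) hge
      have := Nat.le_ceil (η * g / η₂)
      rw [div_le_iff₀ h₂] at this
      push_cast
      have hr0 : (0 : ℝ) ≤ r := Nat.cast_nonneg r
      nlinarith
  · rw [← Real.rpow_natCast, ← Real.rpow_add hQ0]
    refine hmono ?_
    have h5 : ((min k ⌈η * g / η₁⌉₊ : ℕ) : ℝ) ≤ η * g / η₁ + 1 :=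
      (Nat.cast_le.2 (min_le_right _ _)).trans (Nat.ceil_lt_add_one hc1).le
    have h6 : ((min l (r + ⌈η * g / η₂⌉₊) : ℕ) : ℝ) ≤ r + (η * g / η₂ + 1) := by
      refine (Nat.cast_le.2 (min_le_right _ _)).trans ?_
      push_cast
      linarith [(Nat.ceil_lt_add_one hc2).le]
    have h7 := mul_le_mul_of_nonneg_right hηsum hg
    have h8 : (η / η₁ + η / η₂ + η) * g = η * g / η₁ + η * g / η₂ + η * g := by ring
    rw [h8] at h7
    push_cast at h5 h6 ⊢
    linarith

/-- The mean square estimate for the function `n ↦ f(q ^ μ₀ n)`, without a periodic factor. -/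
theorem exists_sum_sq_norm_le {ι : Type*} [Fintype ι] (ω : Module.Basis ι ℤ (𝓞 K))
    (nrm : Seminorm ℝ (ι → ℝ)) (hnrm : ∀ x, nrm x = 0 → x = 0) (hqD : IsFNS q D) {η₂ : ℝ}
    (hη₂ : IsCarryConstant q D η₂) (C₁ C₂ : ℝ) :
    ∃ C : ℝ, ∀ (f : 𝓞 K → ℂ) (η₁ c : ℝ) (γ : ℕ → ℝ), (∀ n, ‖f n‖ = 1) →
      CarryProperty q D f η₁ C₁ → FourierProperty q D f γ c C₂ →
      ∀ μ₀ l k : ℕ, (μ₀ : ℝ) ≤ c * l → ∀ H : Finset K,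
        (∀ h ∈ H, h ∈ frequencySet ω nrm q k) → ∀ t : K,
        ∑ h ∈ H, ‖∑ n ∈ digitSet q D (l + k),
            f (q ^ μ₀ * n) * traceChar (-(h / (q : K) ^ (l + k) + t) * (n : K))‖ ^ 2 ≤
          C * absNorm q ^ (2 * (l + k)) *
            (absNorm q ^ (-(2 * η₁ * η₂ / ((2 + η₁) * (1 + η₂)) * γ l)) +
              absNorm q ^ (-(η₁ * k))) := by
  obtain ⟨h₂, h₂', C₀, hC₀⟩ := hη₂
  obtain ⟨m, hbessel⟩ := exists_frequencySet_bessel ω nrm hnrm hqD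
  obtain ⟨r, hblock⟩ := exists_le_norm_sum_traceChar ω nrm hnrm hqD
  set Q := absNorm q with hQ
  have hQ1 : 1 < Q := hqD.one_lt_absNorm
  have hQ0 : 0 < Q := hqD.absNorm_pos
  have hpow : ∀ y : ℝ, 0 < Q ^ y := fun y => Real.rpow_pos_of_pos hQ0 y
  have hC₀0 : 0 ≤ C₀ := nonneg_of_mul_nonneg_left
    ((Nat.cast_nonneg _).trans (hC₀ 0 0 0 le_rfl le_rfl)) (hpow _)
  refine ⟨8 * m * (|C₁| + C₀ * (1 + C₂ ^ 2) + C₂ ^ 2 * Q ^ (r + 2)) + m * (C₂ ^ 2 * Q ^ r), ?_⟩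
  intro f η₁ c γ hf1 hcarry hfour μ₀ l k hl H hH t
  have h₁ : 0 < η₁ := hcarry.1
  have hC₁ : 0 ≤ C₁ := hcarry.const_nonneg hqD
  obtain ⟨hη, hη2, hηsum⟩ := rate_bounds h₁ h₂
  set η := 2 * η₁ * η₂ / ((2 + η₁) * (1 + η₂)) with hηdef
  have hγ : 0 ≤ γ l := hfour.2.1 l
  have hrate := hqD.rpow_two_mul_rate_le hf1 hfour l
  rw [← hQ] at hrate
  have hW1 := hpow (-(η * γ l))
  have hW2 := hpow (-(η₁ * k))
  have hC1' := abs_nonneg C₁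
  rcases le_or_gt r l with hr | hr
  · obtain ⟨ρ₁, ρ₂, hρ₁, hρ₂, hrρ, e1, e2, e3⟩ :=
      exists_block_lengths (k := k) hQ1 h₁ h₂ h₂' hη hη2 hηsum hγ hr hrate
    have main := hqD.sum_sq_norm_frequencies_le_rpow hC₀ hf1 hcarry hfour hl hρ₁ hρ₂ H
      (fun h => h / (q : K) ^ (l + k)) (hbessel k l H hH)
      (fun h hh => hblock k l (l - ρ₂) (by omega) h (hH h hh)) t
    refine main.trans ?_
    rw [← hQ]
    set W := Q ^ (-(η * γ l)) + Q ^ (-(η₁ * k)) with hW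
    have hW0 : 0 ≤ W := by positivity
    have e4 : C₁ * Q ^ (-(η₁ * ρ₁)) + C₀ * Q ^ (-(η₂ * ρ₂)) +
        C₂ ^ 2 * Q ^ (ρ₁ + ρ₂ - 2 * γ l) ≤
        (|C₁| + C₀ * (1 + C₂ ^ 2) + C₂ ^ 2 * Q ^ (r + 2)) * W := by
      have e5 : Q ^ (-(η * γ l)) ≤ W := le_add_of_nonneg_right hW2.le
      rw [add_mul, add_mul, mul_assoc C₀, mul_assoc (C₂ ^ 2), abs_of_nonneg hC₁]
      refine add_le_add (add_le_add ?_ ?_) ?_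
      · exact mul_le_mul_of_nonneg_left e1 hC₁
      · exact mul_le_mul_of_nonneg_left (e2.trans (by gcongr)) hC₀0
      · exact mul_le_mul_of_nonneg_left (e3.trans (by gcongr)) (sq_nonneg _)
    calc 8 * m * Q ^ (2 * (l + k)) * _
        ≤ 8 * m * Q ^ (2 * (l + k)) *
          ((|C₁| + C₀ * (1 + C₂ ^ 2) + C₂ ^ 2 * Q ^ (r + 2)) * W) := by gcongr
      _ = 8 * m * (|C₁| + C₀ * (1 + C₂ ^ 2) + C₂ ^ 2 * Q ^ (r + 2)) * Q ^ (2 * (l + k)) * W := by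
          ring
      _ ≤ _ := by
          gcongr
          exact le_add_of_nonneg_right (by positivity)
  -- For `l < r` there is no room for a block, but then `Q ^ (2γ(l))` is bounded and the trivial
  -- Bessel bound suffices.
  · have h5 := hbessel k l H hH fun n => f (q ^ μ₀ * n) * traceChar (-t * (n : K))
    simp only [norm_mul, hf1, norm_traceChar, mul_one, one_pow, Finset.sum_const, nsmul_eq_mul,
      hqD.card_digitSet] at h5
    have h6 : ∀ (h : K) (n : 𝓞 K), f (q ^ μ₀ * n) * traceChar (-t * (n : K)) *
        traceChar (-(h / (q : K) ^ (l + k)) * (n : K)) =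
        f (q ^ μ₀ * n) * traceChar (-(h / (q : K) ^ (l + k) + t) * (n : K)) := by
      intro h n
      rw [mul_assoc, ← traceChar_add]
      ring_nf
    simp_rw [h6] at h5
    refine h5.trans ?_
    rw [← hQ]
    have h7 : 1 ≤ C₂ ^ 2 * Q ^ r * Q ^ (-(η * γ l)) := by
      have h8 : Q ^ (η * γ l) ≤ C₂ ^ 2 * Q ^ r := by
        refine (Real.rpow_le_rpow_of_exponent_le hQ1.le
          (by nlinarith : η * γ l ≤ 2 * γ l)).trans (hrate.trans ?_)
        rw [Real.rpow_natCast]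
        gcongr
        exact hQ1.le
      have h9 : Q ^ (η * γ l) * Q ^ (-(η * γ l)) = 1 := by
        rw [← Real.rpow_add hQ0, add_neg_cancel, Real.rpow_zero]
      rw [← h9]
      exact mul_le_mul_of_nonneg_right h8 hW1.le
    calc (m : ℝ) * (Q ^ (l + k) * Q ^ (l + k)) = m * Q ^ (2 * (l + k)) * 1 := by
          rw [two_mul (l + k), pow_add Q (l + k)]
          ring
      _ ≤ m * Q ^ (2 * (l + k)) * (C₂ ^ 2 * Q ^ r * Q ^ (-(η * γ l))) := by gcongr
      _ = m * (C₂ ^ 2 * Q ^ r) * Q ^ (2 * (l + k)) * Q ^ (-(η * γ l)) := by ring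
      _ ≤ _ := by
          gcongr
          · exact le_add_of_nonneg_left (by positivity)
          · exact le_add_of_nonneg_right hW2.le

end MainEstimate

/-! ### Removal of the periodic factor. -/

section Conclusion

variable {q : 𝓞 K} {D : Finset (𝓞 K)}

/-- The Fourier expansion of a function that is periodic modulo `q ^ L`. -/
theorem IsFNS.exists_expansion (hqD : IsFNS q D) {L : ℕ} {T : Finset K} (hT : IsDualSystem q L T)
    {P : 𝓞 K → ℂ} (hP : ∀ n, ‖P n‖ ≤ 1) (hper : ∀ n, P n = P (lowDigits q D L n)) :
    ∃ p : K → ℂ, (∀ s, ‖p s‖ ≤ 1) ∧ ∀ n : 𝓞 K, P n = ∑ s ∈ T, p s * traceChar (s * (n : K)) := by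
  set Q := absNorm q with hQ
  have hQ0 : 0 < Q := hqD.absNorm_pos
  have hQL : ((Q : ℂ) ^ L) ≠ 0 := pow_ne_zero _ (by exact_mod_cast hQ0.ne')
  refine ⟨fun s => (∑ b ∈ digitSet q D L, P b * traceChar (s * ((-b : 𝓞 K) : K))) / (Q : ℂ) ^ L,
    fun s => ?_, fun n => ?_⟩
  · rw [norm_div, norm_pow, Complex.norm_real, Real.norm_of_nonneg hQ0.le,
      div_le_one (pow_pos hQ0 L), ← hqD.card_digitSet, ← mul_one ((digitSet q D L).card : ℝ),
      ← nsmul_eq_mul]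
    refine (norm_sum_le _ _).trans (Finset.sum_le_card_nsmul _ _ _ fun b _ => ?_)
    rw [norm_mul, norm_traceChar, mul_one]
    exact hP b
  · have h1 : ∀ s ∈ T, (∑ b ∈ digitSet q D L, P b * traceChar (s * ((-b : 𝓞 K) : K))) /
        (Q : ℂ) ^ L * traceChar (s * (n : K)) =
        ∑ b ∈ digitSet q D L, P b / (Q : ℂ) ^ L * traceChar (s * ((n - b : 𝓞 K) : K)) := by
      intro s _
      rw [Finset.sum_div, Finset.sum_mul]
      refine Finset.sum_congr rfl fun b _ => ?_
      have h2 : traceChar (s * ((n - b : 𝓞 K) : K)) =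
          traceChar (s * ((-b : 𝓞 K) : K)) * traceChar (s * (n : K)) := by
        rw [← traceChar_add]
        congr 1
        push_cast
        ring
      rw [h2]
      ring
    rw [Finset.sum_congr rfl h1, Finset.sum_comm]
    simp_rw [← Finset.mul_sum, hT.sum_eq]
    rw [Finset.sum_eq_single (lowDigits q D L n)]
    · rw [if_pos (hqD.lowDigits_spec L n).2, ← hper, ← hQ, div_mul_cancel₀ _ hQL]
    · intro b hb hne
      rw [if_neg fun h => hne (hqD.lowDigits_eq hb h).symm, mul_zero]
    · exact fun h => absurd (hqD.lowDigits_mem L n) h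

/-- Multiplication by a function periodic modulo `q ^ L` costs at most a factor `Q ^ (2 L)` in a
mean square estimate that is uniform in the shift. -/
theorem IsFNS.sum_sq_norm_mul_periodic_le (hqD : IsFNS q D) (L : ℕ)
    {P : 𝓞 K → ℂ} (hP : ∀ n, ‖P n‖ ≤ 1) (hper : ∀ n, P n = P (lowDigits q D L n))
    (S : Finset (𝓞 K)) (F : 𝓞 K → ℂ) (H : Finset K) (x : K → K) {X : ℝ}
    (hX : ∀ t : K, ∑ h ∈ H, ‖∑ n ∈ S, F n * traceChar (-(x h + t) * (n : K))‖ ^ 2 ≤ X) (t : K) :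
    ∑ h ∈ H, ‖∑ n ∈ S, F n * P n * traceChar (-(x h + t) * (n : K))‖ ^ 2 ≤
      absNorm q ^ (2 * L) * X := by
  obtain ⟨T, hT⟩ := hqD.exists_isDualSystem L
  obtain ⟨p, hp, hexp⟩ := hqD.exists_expansion hT hP hper
  set Q := absNorm q with hQ
  have hQ0 : 0 < Q := hqD.absNorm_pos
  have h1 : ∀ h, ‖∑ n ∈ S, F n * P n * traceChar (-(x h + t) * (n : K))‖ ^ 2 ≤
      Q ^ L * ∑ s ∈ T, ‖∑ n ∈ S, F n * traceChar (-(x h + (t - s)) * (n : K))‖ ^ 2 := by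
    intro h
    have h2 : ∑ n ∈ S, F n * P n * traceChar (-(x h + t) * (n : K)) =
        ∑ s ∈ T, p s * ∑ n ∈ S, F n * traceChar (-(x h + (t - s)) * (n : K)) := by
      simp_rw [Finset.mul_sum]
      rw [Finset.sum_comm]
      refine Finset.sum_congr rfl fun n _ => ?_
      rw [hexp n, Finset.mul_sum, Finset.sum_mul]
      refine Finset.sum_congr rfl fun s _ => ?_
      rw [show -(x h + (t - s)) * (n : K) = s * (n : K) + -(x h + t) * (n : K) by ring,
        traceChar_add]
      ring
    rw [h2]
    -- Cauchy-Schwarz over the `Q ^ L` characters gives one factor `Q ^ L`; summing the uniform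
    -- bound `X` over as many shifts gives the other.
    refine (sq_norm_sum_le_card_mul _ _).trans ?_
    rw [hT.card_eq]
    refine mul_le_mul_of_nonneg_left (Finset.sum_le_sum fun s _ => ?_) (by positivity)
    refine pow_le_pow_left₀ (norm_nonneg _) ?_ 2
    rw [norm_mul]
    exact mul_le_of_le_one_left (norm_nonneg _) (hp s)
  refine (Finset.sum_le_sum fun h _ => h1 h).trans ?_
  rw [← Finset.mul_sum, Finset.sum_comm]
  have h3 := Finset.sum_le_card_nsmul T _ _ (fun s _ => hX (t - s))
  rw [nsmul_eq_mul, hT.card_eq] at h3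
  refine (mul_le_mul_of_nonneg_left h3 (by positivity)).trans (le_of_eq ?_)
  rw [two_mul, pow_add]
  ring

theorem IsFNS.truncate_pow_mul_periodic (hqD : IsFNS q D) (f : 𝓞 K → ℂ) (μ₀ τ : ℕ) (n : 𝓞 K) :
    truncate q D f (μ₀ + τ) (q ^ μ₀ * n) =
      truncate q D f (μ₀ + τ) (q ^ μ₀ * lowDigits q D τ n) := by
  unfold truncate
  congr 1
  refine hqD.lowDigits_congr ?_
  obtain ⟨j, hj⟩ := (hqD.lowDigits_spec τ n).2
  exact ⟨j, by rw [← mul_sub, hj, pow_add]; ring⟩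

/-- For `n ∈ 𝒩_σ` the product `q ^ μ₀ n` has at most `μ₀ + σ` digits, so the outer truncation
disappears. -/
theorem IsFNS.discreteFourier_middleFunction (hqD : IsFNS q D) (f : 𝓞 K → ℂ) (μ₀ μ₁ σ : ℕ)
    (h t : K) :
    discreteFourier q D σ (middleFunction q D f μ₀ μ₁ (μ₀ + σ)) (h + t) =
      (1 / (absNorm q : ℂ) ^ σ) * ∑ n ∈ digitSet q D σ, f (q ^ μ₀ * n) *
        star (truncate q D f μ₁ (q ^ μ₀ * n)) *
          traceChar (-(h / (q : K) ^ σ + t / (q : K) ^ σ) * (n : K)) := by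
  unfold discreteFourier
  congr 1
  refine Finset.sum_congr rfl fun n hn => ?_
  unfold middleFunction
  rw [truncate, hqD.lowDigits_of_mem (hqD.pow_mul_mem hn)]
  congr 2
  ring

end Conclusion

end DigitalFourier

end

theorem proposition3 {K : Type*} [Field K] [NumberField K] {ι : Type*} [Fintype ι]
    (ω : Module.Basis ι ℤ (𝓞 K)) (nrm : Seminorm ℝ (ι → ℝ)) (hnrm : ∀ x, nrm x = 0 → x = 0)
    (q : 𝓞 K) (D : Finset (𝓞 K)) (hqD : DigitalFourier.IsFNS q D) :
    (∃ η₂ : ℝ, DigitalFourier.IsCarryConstant q D η₂) ∧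
    ∀ η₂ : ℝ, DigitalFourier.IsCarryConstant q D η₂ → ∀ C₁ C₂ : ℝ, ∃ C : ℝ,
      ∀ (f : 𝓞 K → ℂ) (η₁ c : ℝ) (γ : ℕ → ℝ),
        (∀ n, ‖f n‖ = 1) →
        DigitalFourier.CarryProperty q D f η₁ C₁ →
        DigitalFourier.FourierProperty q D f γ c C₂ →
        ∀ μ₀ μ₁ μ μ₂ σ l : ℕ, μ₀ < μ₁ → μ₁ < μ → μ < μ₂ → σ = μ₂ - μ₀ →
          c⁻¹ * (μ₀ : ℝ) ≤ (l : ℝ) → l ≤ σ → ∀ t : K,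
            (DigitalFourier.frequencySet ω nrm q (σ - l)).Finite ∧
            ∑ᶠ h ∈ DigitalFourier.frequencySet ω nrm q (σ - l),
                ‖DigitalFourier.discreteFourier q D σ
                  (DigitalFourier.middleFunction q D f μ₀ μ₁ μ₂) (h + t)‖ ^ 2
              ≤ C * DigitalFourier.absNorm q ^ (2 * ((μ₁ : ℝ) - (μ₀ : ℝ))) *
                (DigitalFourier.absNorm q ^
                    (-(2 * η₁ * η₂ / ((2 + η₁) * (1 + η₂)) * γ l)) +
                  DigitalFourier.absNorm q ^ (-(η₁ * ((σ : ℝ) - (l : ℝ))))) := by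
  refine ⟨hqD.exists_isCarryConstant, fun η₂ hη₂ C₁ C₂ => ?_⟩
  obtain ⟨C, hC⟩ := DigitalFourier.exists_sum_sq_norm_le ω nrm hnrm hqD hη₂ C₁ C₂
  refine ⟨C, fun f η₁ c γ hf1 hcarry hfour μ₀ μ₁ μ μ₂ σ l h01 h1 h2 hσ hl hlσ t => ?_⟩
  have hμ₂ : μ₂ = μ₀ + σ := by omega
  subst hμ₂
  obtain ⟨k, rfl⟩ := Nat.exists_eq_add_of_le hlσ
  obtain ⟨τ, rfl⟩ := Nat.exists_eq_add_of_le h01.le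
  rw [Nat.add_sub_cancel_left]
  have hfin := DigitalFourier.finite_frequencySet ω nrm hnrm hqD k
  refine ⟨hfin, ?_⟩
  rw [finsum_mem_eq_finite_toFinset_sum _ hfin]
  set Q := DigitalFourier.absNorm q with hQ
  have hQ0 : 0 < Q := hqD.absNorm_pos
  have hc : 0 < c := hfour.2.2.1
  have hlc : (μ₀ : ℝ) ≤ c * l := by
    rwa [inv_mul_le_iff₀ hc] at hl
  -- The periodic factor has period `q ^ τ` with `τ = μ₁ - μ₀`; this is the source of `Q ^ (2(μ₁ -
  -- μ₀))`.
  have main := hqD.sum_sq_norm_mul_periodic_le τ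
    (P := fun n => star (DigitalFourier.truncate q D f (μ₀ + τ) (q ^ μ₀ * n)))
    (fun n => by rw [norm_star]; exact (hf1 _).le)
    (fun n => congrArg star (hqD.truncate_pow_mul_periodic f μ₀ τ n))
    (DigitalFourier.digitSet q D (l + k)) (fun n => f (q ^ μ₀ * n)) hfin.toFinset
    (fun h => h / (q : K) ^ (l + k))
    (fun t => hC f η₁ c γ hf1 hcarry hfour μ₀ l k hlc hfin.toFinset
      (fun h hh => hfin.mem_toFinset.1 hh) t) (t / (q : K) ^ (l + k))
  simp_rw [hqD.discreteFourier_middleFunction, norm_mul, mul_pow]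
  rw [← Finset.mul_sum]
  have hnorm : ‖(1 : ℂ) / (Q : ℂ) ^ (l + k)‖ ^ 2 = (Q ^ (2 * (l + k)))⁻¹ := by
    rw [norm_div, norm_pow, Complex.norm_real, Real.norm_of_nonneg hQ0.le, norm_one, one_div,
      inv_pow, ← pow_mul, mul_comm (l + k)]
  rw [← hQ, hnorm]
  refine (mul_le_mul_of_nonneg_left main (inv_nonneg.2 (pow_pos hQ0 _).le)).trans (le_of_eq ?_)
  have e1 : Q ^ (2 * (((μ₀ + τ : ℕ) : ℝ) - μ₀)) = Q ^ (2 * τ) := by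
    rw [← Real.rpow_natCast]
    congr 1
    push_cast
    ring
  have e2 : (((l + k : ℕ) : ℝ) - l) = k := by
    push_cast
    ring
  rw [e1, e2, ← hQ]
  field_simp
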